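/- **Theorem (SFFT).** For $N\ge 1$ let $e_\omega[\tau]=N^{-1/2}e^{2\pi i\omega\tau/N}$ on $\mathbb Z_N$, and consider the signal $$S[\tau]=\sum_{j=1}^k\alpha_j\,e_{\omega_j}[\tau]+\nu_\tau ,\qquad \tau\in\mathbb Z_N,$$ under the following assumptions. * *Sparsity:* $k\ge 1$ does not depend on $N$; the frequencies $\omega_1,\dots,\omega_k\in\mathbb Z_N$ are distinct for all sufficiently large $N$, and otherwise arbitrary. * *$\epsilon$-coefficients:* for some $A>0$ and $\epsilon\in(0,1)$ (not depending on $N$), $(\alpha_1,\dots,\alpha_k)$ is drawn uniformly (normalised surface measure) from $B_\epsilon=\{x\in\mathbb C^k:\|x\|^2=A,\ \min_{x_j\neq0}|x_j|\ge\epsilon\sqrt{A/k}\}$. * *Sub-Gaussian noise:* the $\nu_\tau$ are i.i.d., independent of the coefficients, mean zero and sub-Gaussian with parameter $s^2/N$, $s>0$, i.e. $\mathbb E\,e^{t\,\mathrm{Re}(\bar u\nu_\tau)}\le e^{s^2t^2/(2N)}$ for all $t\in\mathbb R$ and all $u\in\mathbb C$ with $|u|=1$. Put $\mathrm{SNR}=A/s^2$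 and $\mu=\kappa\,\epsilon\sqrt{A/k}$ with $\kappa\in(0,1)$. *The procedure $\mathrm{SFFT}_\mu$.* An implementation on $\mathbb Z_N$ consists of numbers $n_{perm},n_I,n_{thr}\ge0$, a filter $F:\mathbb Z_N\to\mathbb C$ with $|\sum_\tau F[\tau]e^{-2\pi i\omega\tau/N}|\le1$ for all $\omega$, a precision $b$, and a location procedure for $1$-sparse signals. It draws $n_{perm}$ independent uniform pairs $(\sigma,a)\in\mathbb Z_N^\times\times\mathbb Z_N$. For each pair and each $j=0,\dots,n_I-1$ it applies $1\mathrm{SFFT}_\mu$ to $$S_j=S^{\sigma,a}*\bigl(F\cdot e^{2\pi i\lfloor jN/n_I\rfloor(\cdot)/N}\bigr),\qquad S^{\sigma,a}[\tau]=e^{2\pi ia\tau/N}S[\sigma\tau].$$ $1\mathrm{SFFT}_\mu$ runs the location procedure, a straight-line program over index registers (values in $\mathbb Z_N$, ring operations, comparison-controlled selection, random indices) and complex registers (arithmetic, conjugation, roots of unity) that may request samples of $S_j$, and obtains a frequency $\hat\omega$; it then forms the estimate $\hat\alpha=\frac{N}{n_{thr}}\sum_iS_j[\tau_i]\,e_{-\hat\omega}[\tau_i]$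 at $n_{thr}$ uniformly random points $\tau_i$, and discards $\hat\omega$ if $|\hat\alpha|<\mu$. If $\hat\omega$ is not discarded, $\sigma^{-1}(\hat\omega-a)$ is returned. The random choices belonging to one pair $(\sigma,a)$ are shared by all $j$. Complex data (including the samples of $S$) and arithmetic are in saturating fixed point with $b$ fractional bits and range $[-2^b,2^b]$ for real and imaginary parts. *Samples* counts all evaluations of $S$; *operations* counts all arithmetic operations, comparisons, samplings and random draws; *memory* counts the bits of all stored data ($\lceil\log_2N\rceil$ per element of $\mathbb Z_N$, $2(2b+2)$ per complex number, and loop counters; an implementation with $n_{perm}=0$ uses none). **Claim.** For every $\kappa\in(0,1)$ there are constants $c_1,c_2,c_3>0$, independent of $\epsilon$, $\mathrm{SNR}$, $k$ and $N$, such that for all $k\ge1$, $A>0$, $\epsilon\in(0,1)$, $s>0$ there are implementations of $\mathrm{SFFT}_\mu$, one for every $N$, that take at most 1. $c_1k(\log N)^3(\epsilon^2\,\mathrm{SNR})^{-1}$ samples, 2. $c_2k(\log N)^3(\epsilon^2\,\mathrm{SNR})^{-1}$ bits of memory, and 3. $c_3k(\log N)^3(\epsilon^2\,\mathrm{SNR})^{-1}+k^2$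 operations, and for which, for all noise laws and all frequencies as above and every $j$, the probability of detection, i.e. the probability that $\omega_j$ is among the returned frequencies (over coefficients, noise and the independent random choices of the algorithm), tends to $1$ as $N\to\infty$. -/

import Mathlib

open MeasureTheory ProbabilityTheory Filter Topology
open scoped NNReal ENNReal

noncomputable section

namespace SparseFourier

/-! ### The signal model -/

/-- The normalised exponential `e_ω[τ] = N^{-1/2} exp(2πi ω τ / N)` on `ℤ_N`. -/
def expVec {N : ℕ} [NeZero N] (ω τ : ZMod N) : ℂ :=
  ZMod.stdAddChar (ω * τ) / (Real.sqrt N : ℂ)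

/-- The observed signal `S[τ] = ∑ⱼ αⱼ e_{ωⱼ}[τ] + ν_τ`. -/
def signal {N k : ℕ} [NeZero N] (ω : Fin k → ZMod N) (α : EuclideanSpace ℂ (Fin k))
    (ν : ZMod N → ℂ) (τ : ZMod N) : ℂ :=
  ∑ j, α j * expVec (ω j) τ + ν τ

/-- The set `B_ε` of coefficient vectors of energy `A` all of whose non-zero entries have modulus
at least `ε √(A / k)`. -/
def coeffSet (k : ℕ) (A ε : ℝ) : Set (EuclideanSpace ℂ (Fin k)) :=
  {x | ‖x‖ ^ 2 = A ∧ ∀ j, x j ≠ 0 → ε * Real.sqrt (A / k) ≤ ‖x j‖}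

/-- The surface measure (up to a constant factor) of the sphere `‖x‖² = A` in `ℂ^k`. -/
def sphereMeasure (k : ℕ) (A : ℝ) : Measure (EuclideanSpace ℂ (Fin k)) :=
  ((volume : Measure (EuclideanSpace ℂ (Fin k))).toSphere).map
    fun u : Metric.sphere (0 : EuclideanSpace ℂ (Fin k)) 1 =>
      Real.sqrt A • (u : EuclideanSpace ℂ (Fin k))

/-- The uniform distribution on `B_ε`: normalised surface measure conditioned on `B_ε`. -/
def coeffLaw (k : ℕ) (A ε : ℝ) : Measure (EuclideanSpace ℂ (Fin k)) :=
  ProbabilityTheory.cond (sphereMeasure k A) (coeffSet k A ε)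

/-- `P` is the law of a mean zero complex random variable that is sub-Gaussian with parameter `v`:
for every direction `u` of the plane, the component `X` of the variable in the direction `u`
satisfies `E exp(t X) ≤ exp(v t² / 2)` for all real `t`. A real sub-Gaussian variable with
parameter `v`, regarded as a complex one, is an instance. -/
structure IsSubgaussianNoise (P : Measure ℂ) (v : ℝ) : Prop where
  isProbabilityMeasure : IsProbabilityMeasure P
  mean_zero : ∫ z, z ∂P = 0
  subgaussian : ∀ u : ℂ, ‖u‖ = 1 →
    HasSubgaussianMGF (fun z : ℂ => (starRingEnd ℂ u * z).re) v.toNNReal P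

/-! ### Fixed-point numbers

Complex data are held in fixed point: real and imaginary part are multiples of `2^{-b}` in the
range `[-2^b, 2^b]`, so that a complex cell has `2 (2 b + 2)` bits. -/

/-- Rounding of a real number to precision `b`, with saturation. -/
def roundReal (b : ℕ) (x : ℝ) : ℝ :=
  max (-(2 : ℝ) ^ b) (min ((2 : ℝ) ^ b) ((round ((2 : ℝ) ^ b * x) : ℤ) / (2 : ℝ) ^ b))

/-- Rounding of a complex number to precision `b`. -/
def rnd (b : ℕ) (z : ℂ) : ℂ := ⟨roundReal b z.re, roundReal b z.im⟩

/-! ### The language of 1-sparse location procedures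

Straight-line programs over two banks of registers, index registers with values in `ℤ_N` and
complex registers with fixed-point values. Every instruction is one operation. The program sees the
signal only through the instruction `sample`, and randomness only through `idxSeed`. -/

inductive Instr (N : ℕ) : Type
  | idxConst (d : ℕ) (z : ZMod N)
  | idxSeed (d i : ℕ)
  | idxAdd (d i j : ℕ)
  | idxSub (d i j : ℕ)
  | idxMul (d i j : ℕ)
  | idxSelect (d a b i j : ℕ)
  | const (d : ℕ) (z : ℂ)
  | add (d a b : ℕ)
  | sub (d a b : ℕ)
  | mul (d a b : ℕ)
  | div (d a b : ℕ)
  | conj (d a : ℕ)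
  | char (d i : ℕ)
  | sample (d i : ℕ)

/-- Contents of the registers. -/
structure RegState (N : ℕ) : Type where
  idx : ℕ → ZMod N
  val : ℕ → ℂ

namespace RegState

def setIdx {N : ℕ} (s : RegState N) (d : ℕ) (z : ZMod N) : RegState N :=
  { s with idx := Function.update s.idx d z }

def setVal {N : ℕ} (s : RegState N) (d : ℕ) (z : ℂ) : RegState N :=
  { s with val := Function.update s.val d z }

/-- All registers hold zero. -/
def init (N : ℕ) : RegState N := ⟨fun _ => 0, fun _ => 0⟩

end RegState

namespace Instr

/-- Execution of an instruction at precision `b`, for the signal `X` and the random indices `u`.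
`idxSelect d a b i j` copies index register `i` or `j` to `d`, according to whether
`Re val a ≤ Re val b`. `char d i` evaluates `exp(2πi x / N)` at `x = idx i`. -/
def exec {N n : ℕ} [NeZero N] (b : ℕ) (X : ZMod N → ℂ) (u : Fin n → ZMod N) :
    Instr N → RegState N → RegState N
  | idxConst d z, s => s.setIdx d z
  | idxSeed d i, s => s.setIdx d (if h : i < n then u ⟨i, h⟩ else 0)
  | idxAdd d i j, s => s.setIdx d (s.idx i + s.idx j)
  | idxSub d i j, s => s.setIdx d (s.idx i - s.idx j)
  | idxMul d i j, s => s.setIdx d (s.idx i * s.idx j)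
  | idxSelect d a c i j, s =>
      haveI := Classical.propDecidable ((s.val a).re ≤ (s.val c).re)
      s.setIdx d (if (s.val a).re ≤ (s.val c).re then s.idx i else s.idx j)
  | const d z, s => s.setVal d (rnd b z)
  | add d a c, s => s.setVal d (rnd b (s.val a + s.val c))
  | sub d a c, s => s.setVal d (rnd b (s.val a - s.val c))
  | mul d a c, s => s.setVal d (rnd b (s.val a * s.val c))
  | div d a c, s => s.setVal d (rnd b (s.val a / s.val c))
  | conj d a, s => s.setVal d (rnd b (starRingEnd ℂ (s.val a)))
  | char d i, s => s.setVal d (rnd b (ZMod.stdAddChar (s.idx i)))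
  | sample d i, s => s.setVal d (rnd b (X (s.idx i)))

/-- Is the instruction a request for a sample? -/
def isSample {N : ℕ} : Instr N → Bool
  | sample _ _ => true
  | _ => false

/-- The index register that the instruction writes, if any. -/
def idxDest {N : ℕ} : Instr N → Option ℕ
  | idxConst d _ => some d
  | idxSeed d _ => some d
  | idxAdd d _ _ => some d
  | idxSub d _ _ => some d
  | idxMul d _ _ => some d
  | idxSelect d _ _ _ _ => some d
  | _ => none

/-- The complex register that the instruction writes, if any. -/
def valDest {N : ℕ} : Instr N → Option ℕ
  | const d _ => some d
  | add d _ _ => some d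
  | sub d _ _ => some d
  | mul d _ _ => some d
  | div d _ _ => some d
  | conj d _ => some d
  | char d _ => some d
  | sample d _ => some d
  | _ => none

end Instr

/-- The state after the execution of a program, started with all registers zero. -/
def runProgram {N n : ℕ} [NeZero N] (b : ℕ) (X : ZMod N → ℂ) (u : Fin n → ZMod N)
    (p : List (Instr N)) : RegState N :=
  p.foldl (fun s i => i.exec b X u s) (RegState.init N)

/-! ### Implementations of the sparse Fourier transform -/

/-- The choices that make up an implementation of `SFFT_μ` on `ℤ_N`:
the number `nPerm` of random spectral permutations, the filter `F`, whose gain is at most one at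
every frequency, the number `nInt` of intervals to which the signal is filtered, the
location procedure of the 1-sparse algorithm with the number `nSeed` of uniformly random indices
that it uses, the number `nThr` of uniformly random sample points at which the
1-sparse algorithm estimates the coefficient, and the precision of the arithmetic. -/
structure SFFTImpl (N : ℕ) [NeZero N] : Type where
  nPerm : ℕ
  nInt : ℕ
  nSeed : ℕ
  nThr : ℕ
  prec : ℕ
  F : ZMod N → ℂ
  gain_le : ∀ ω : ZMod N, ‖∑ τ, F τ * ZMod.stdAddChar (-(ω * τ))‖ ≤ 1
  locate : List (Instr N)

namespace SFFTImpl

variable {N : ℕ} [NeZero N]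

open Classical in
/-- The support of the filter. -/
def support (I : SFFTImpl N) : Finset (ZMod N) := Finset.univ.filter fun τ => I.F τ ≠ 0

/-- The size of the support of the filter. -/
def nF (I : SFFTImpl N) : ℕ := I.support.card

/-- The number of samples of its input that the 1-sparse algorithm uses. -/
def nOne (I : SFFTImpl N) : ℕ := I.locate.countP Instr.isSample + I.nThr

/-- The random choices that belong to one spectral permutation `(σ, a)`: the unit `σ`, the
frequency shift `a`, the random indices of the location procedure, and the sample points for
the coefficient. -/
abbrev Draw (I : SFFTImpl N) : Type :=
  (ZMod N)ˣ × ZMod N × (Fin I.nSeed → ZMod N) × (Fin I.nThr → ZMod N)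

/-- The frequency shift `⌊j N / n_I⌋` of the filter for the `j`-th interval. -/
def shift (I : SFFTImpl N) (j : Fin I.nInt) : ZMod N := ((j.val * N / I.nInt : ℕ) : ZMod N)

/-- The sample at `τ` of the permuted and filtered signal
`S_j = S^{σ,a} * (F · e^{2πi c (·) / N})`, where `S^{σ,a}[τ] = e^{2πi a τ / N} S[σ τ]`:
the sum over the support of `F` of
`F[τ'] e^{2πi (c τ' + a (τ - τ')) / N} S[σ (τ - τ')]`, in fixed-point arithmetic. -/
def filtered (I : SFFTImpl N) (S : ZMod N → ℂ) (σ : (ZMod N)ˣ) (a c τ : ZMod N) : ℂ :=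
  I.support.toList.foldl
    (fun acc τ' => rnd I.prec (acc + rnd I.prec
      (rnd I.prec (rnd I.prec (I.F τ') * rnd I.prec (ZMod.stdAddChar (c * τ' + a * (τ - τ'))))
        * rnd I.prec (S (σ * (τ - τ')))))) 0

/-- The frequency found by the location procedure in the signal `X`: the value of index register
`0` when the program ends. -/
def location (I : SFFTImpl N) (X : ZMod N → ℂ) (u : Fin I.nSeed → ZMod N) : ZMod N :=
  (runProgram I.prec X u I.locate).idx 0

/-- The estimate `(N / n) ∑ᵢ X[τᵢ] e_{-ω}[τᵢ] = (√N / n) ∑ᵢ X[τᵢ] e^{-2πi ω τᵢ / N}` of the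
coefficient of `e_ω` in `X`, with the sum in fixed-point arithmetic. -/
def coeff (I : SFFTImpl N) (X : ZMod N → ℂ) (ω : ZMod N) (t : Fin I.nThr → ZMod N) : ℂ :=
  ((Real.sqrt N / I.nThr : ℝ) : ℂ) *
    (List.ofFn t).foldl
      (fun acc τ => rnd I.prec (acc + rnd I.prec
        (X τ * rnd I.prec (ZMod.stdAddChar (-(ω * τ)))))) 0

/-- The frequencies returned by `SFFT_μ` on the signal `S`. For each permutation and each interval,
the 1-sparse algorithm is applied to the filtered signal; a frequency `ω` whose estimated
coefficient has modulus less than `μ` is discarded, otherwise `σ⁻¹ (ω - a)` is returned. -/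
def returned (I : SFFTImpl N) (μ : ℝ) (S : ZMod N → ℂ) (r : Fin I.nPerm → I.Draw) :
    Set (ZMod N) :=
  {ω | ∃ (p : Fin I.nPerm) (j : Fin I.nInt),
    let σ := (r p).1
    let a := (r p).2.1
    let X := I.filtered S σ a (I.shift j)
    let ω' := I.location X (r p).2.2.1
    μ ≤ ‖I.coeff X ω' (r p).2.2.2‖ ∧ ω = ((σ⁻¹ : (ZMod N)ˣ) : ZMod N) * (ω' - a)}

/-- The number of samples of `S`, counted with multiplicity: every filtered sample takes one sample
of `S` for each point of the support of `F`. -/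
def samples (I : SFFTImpl N) : ℕ := I.nPerm * (I.nInt * (I.nOne * I.nF))

/-- The number of operations. For each permutation: the random draws, and `σ⁻¹` by the extended
Euclidean algorithm (at most `2 log₂ N + 1` division steps of at most five operations). For each
permutation and interval: the shift (2), the location program, the filtered samples
(per point of the support: `τ - τ'`, its products with `σ` and `a`, the product of the shift and
`τ'`, the sum of the phases, the root of unity, the sample, two products, one addition), the
coefficient (per sample point: the phase (2), the root of unity, a product, an addition), the
test of the squared modulus against a constant (4), and `σ⁻¹ (ω - a)` (2). -/
def operations (I : SFFTImpl N) : ℕ :=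
  I.nPerm * (2 + I.nSeed + I.nThr + 10 * (Nat.clog 2 N + 1) +
    I.nInt * (2 + I.locate.length + 10 * (I.nOne * I.nF) + 5 * I.nThr + 4 + 2))

/-- The number of index registers that the location procedure uses. -/
def idxRegs (I : SFFTImpl N) : ℕ := (I.locate.filterMap Instr.idxDest).toFinset.card

/-- The number of complex registers that the location procedure uses. -/
def valRegs (I : SFFTImpl N) : ℕ := (I.locate.filterMap Instr.valDest).toFinset.card

/-- The number of bits of memory. Index cells of `⌈log₂ N⌉` bits: the random indices, the sample
points, the index registers, the support of the filter, the returned frequencies, and 16 cells of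
working space. Complex cells of `2 (2 b + 2)` bits at precision `b`: the complex registers, the
values of the filter, and 12 cells of working space (which include the double length numbers of
the test against `μ`). Finally the loop counters. Without any permutation nothing is done and
nothing is stored. -/
def memoryBits (I : SFFTImpl N) : ℕ :=
  if I.nPerm = 0 then 0 else
    (I.nSeed + I.nThr + I.idxRegs + I.nF + I.nPerm * I.nInt + 16) * Nat.clog 2 N +
    (I.valRegs + I.nF + 12) * (2 * (2 * I.prec + 2)) +
    (Nat.size I.nPerm + Nat.size I.nInt + Nat.size I.nThr + Nat.size I.nF)

/-- The probability that the `j`-th frequency `ω j` is returned. The coefficients are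
uniform on `B_ε`, the noise variables `ν_τ` are i.i.d. with law `P` and independent of the
coefficients, and the random choices of the algorithm are uniform and independent of both. -/
def detectionProb (I : SFFTImpl N) (μ : ℝ) {k : ℕ} (A ε : ℝ) (P : Measure ℂ)
    (ω : Fin k → ZMod N) (j : Fin k) : ℝ≥0∞ :=
  (∑ r : Fin I.nPerm → I.Draw,
    ((coeffLaw k A ε).prod (Measure.pi fun _ : ZMod N => P))
      {x | ω j ∈ I.returned μ (signal ω x.1 x.2) r}) /
  (Fintype.card (Fin I.nPerm → I.Draw) : ℝ≥0∞)

end SFFTImpl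

end SparseFourier

end

/-! Since k, A, ε and s stay fixed while N grows, any scheme of cost o(log³ N) that finds ω_j with
probability tending to 1 suffices: for large N it fits the budget, and for the other N the
implementation without permutations costs nothing. Hence all three constants can be 1.

Let ℓ = ⌈log₂ N⌉ and let q = `scale N` be the integral part of ℓ^(1/16). The scheme `sfft` filters
with the average over q^10 points, uses one interval and draws q^12 permutations. A pair (σ, a) is
good for ω_j if it moves ω_j into [-K, K], K ≈ N/q^11, and keeps the other frequencies at distance
at least about N/q^9 from it. Multiples σd by units are rarely small (`card_units_small_mul_le`),
and φ(N) is at least of order N/√ℓ (`sq_le_totient_sq_mul`), so at least half of all units separate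
the frequencies. A pair is therefore good with probability at least K/N (`le_card_goodPairs`), and
all q^12 draws fail with probability at most exp(-q/2) (`ofReal_le_sum_div_card`).

Under a good pair the response of the filter is 1 + O(1/q) at the moved ω_j and O(1/q) at the other
frequencies, the averaged noise is small by sub-Gaussian tails, and rounding at precision 2ℓ is
negligible. At each of the O(ℓ) sample points the filtered signal is thus a pure tone of frequency
in [-K, K] up to a small relative error. Bisection finds this frequency, each step reading the sign
of one real part; consecutive candidate subintervals overlap, which absorbs the error
(`bisect_correct`). Almost surely no coefficient vanishes (`coeffLaw_fullCoeffSet`), so |α_j| ≥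
ε√(A/k), and κ < 1 leaves room for the threshold (`location_and_coeff_boxImpl`).

The cost is O(ℓ q^22), while q^23 ≤ q^32 ≤ ℓ²; the spare factor q beats every constant
(`costLe_sfft`). -/

noncomputable section

namespace SparseFourier

/-! ### Units of `ℤ_N` -/

/-- The i-th smallest element is at least 2i + 1, and (1 - 1/p)² ≥ 1 - 2/p, so the product dominates
the telescoping product of (2i - 1)/(2i + 1). -/
lemma inv_le_prod_one_sub_inv_sq (s : Finset ℕ) (hs : ∀ p ∈ s, Odd p ∧ 3 ≤ p) :
    1 / (2 * (s.card : ℝ) + 1) ≤ ∏ p ∈ s, (1 - (p : ℝ)⁻¹) ^ 2 := by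
  -- The induction also carries that the largest element of a nonempty `s` is at least 2|s| + 1.
  have key : ∀ s : Finset ℕ, (∀ p ∈ s, Odd p ∧ 3 ≤ p) →
      (∀ p ∈ s, ∃ x ∈ s, p ≤ x ∧ 2 * s.card + 1 ≤ x) ∧
      1 / (2 * (s.card : ℝ) + 1) ≤ ∏ p ∈ s, (1 - (p : ℝ)⁻¹) ^ 2 := by
    intro s
    induction s using Finset.induction_on_max with
    | empty => intro _; simp
    | insert a s hmax ih =>
      intro hs
      have hs' : ∀ p ∈ s, Odd p ∧ 3 ≤ p := fun p hp => hs p (Finset.mem_insert_of_mem hp)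
      obtain ⟨h1, h2⟩ := ih hs'
      have ha : a ∉ s := fun h => lt_irrefl _ (hmax a h)
      obtain ⟨hodd, h3⟩ := hs a (Finset.mem_insert_self _ _)
      have hcard : (insert a s).card = s.card + 1 := Finset.card_insert_of_notMem ha
      have hbig : 2 * (s.card + 1) + 1 ≤ a := by
        rcases s.eq_empty_or_nonempty with rfl | ⟨p, hp⟩
        · simpa using h3
        · obtain ⟨x, hx, -, hx2⟩ := h1 p hp
          have hxa := hmax x hx
          obtain ⟨u, hu⟩ := (hs' x hx).1
          obtain ⟨v, hv⟩ := hodd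
          omega
      refine ⟨fun p hp => ⟨a, Finset.mem_insert_self _ _, ?_, by omega⟩, ?_⟩
      · rcases Finset.mem_insert.1 hp with rfl | hp
        · exact le_rfl
        · exact (hmax p hp).le
      rw [Finset.prod_insert ha, hcard, Nat.cast_add, Nat.cast_one]
      have hbig' : 2 * ((s.card : ℝ) + 1) + 1 ≤ a := by exact_mod_cast hbig
      set m : ℝ := (s.card : ℝ)
      have hm : 0 ≤ m := Nat.cast_nonneg _
      have ha0 : (0 : ℝ) < a := by linarith
      have hfac : (2 * m + 1) / (2 * (m + 1) + 1) ≤ (1 - (a : ℝ)⁻¹) ^ 2 := by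
        have e1 : (2 * m + 1) / (2 * (m + 1) + 1) = 1 - 2 * (2 * (m + 1) + 1)⁻¹ := by
          field_simp; ring
        have e2 : (a : ℝ)⁻¹ ≤ (2 * (m + 1) + 1)⁻¹ := inv_anti₀ (by linarith) hbig'
        rw [e1]
        nlinarith [sq_nonneg ((a : ℝ)⁻¹)]
      calc 1 / (2 * ((m : ℝ) + 1) + 1)
          = (2 * m + 1) / (2 * (m + 1) + 1) * (1 / (2 * m + 1)) := by field_simp
        _ ≤ (1 - (a : ℝ)⁻¹) ^ 2 * ∏ p ∈ s, (1 - (p : ℝ)⁻¹) ^ 2 := by gcongr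
  exact_mod_cast (key s hs).2

lemma two_pow_card_primeFactors_le {n : ℕ} (hn : n ≠ 0) : 2 ^ n.primeFactors.card ≤ n :=
  calc 2 ^ n.primeFactors.card ≤ ∏ p ∈ n.primeFactors, p :=
        Finset.pow_card_le_prod _ _ _ fun _ hp => (Nat.prime_of_mem_primeFactors hp).two_le
    _ ≤ n := Nat.le_of_dvd (Nat.pos_of_ne_zero hn) (Nat.prod_primeFactors_dvd n)

/-- In Euler's product for (φ(n)/n)² the prime 2 contributes 1/4 and the odd primes fall under the
telescoping bound. The loss is only the square root of the number of prime factors. -/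
lemma sq_le_totient_sq_mul (n : ℕ) :
    (n : ℝ) ^ 2 ≤ 4 * (2 * (n.primeFactors.card : ℝ) + 1) * (n.totient : ℝ) ^ 2 := by
  have htot : (n.totient : ℝ) = n * ∏ p ∈ n.primeFactors, (1 - (p : ℝ)⁻¹) := by
    have := Nat.totient_eq_mul_prod_factors n
    have h2 := congrArg (fun x : ℚ => (x : ℝ)) this
    push_cast at h2
    exact h2
  set Q := n.primeFactors.erase 2
  have hQ : 1 / (2 * (Q.card : ℝ) + 1) ≤ ∏ p ∈ Q, (1 - (p : ℝ)⁻¹) ^ 2 := by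
    refine inv_le_prod_one_sub_inv_sq Q fun p hp => ?_
    obtain ⟨h2, hp⟩ := Finset.mem_erase.1 hp
    have hp := Nat.prime_of_mem_primeFactors hp
    have := hp.two_le
    exact ⟨hp.odd_of_ne_two h2, by omega⟩
  have hQn : (Q.card : ℝ) ≤ n.primeFactors.card := by
    exact_mod_cast Finset.card_le_card (Finset.erase_subset _ _)
  have hprod : (1 / 4) * ∏ p ∈ Q, (1 - (p : ℝ)⁻¹) ^ 2
      ≤ ∏ p ∈ n.primeFactors, (1 - (p : ℝ)⁻¹) ^ 2 := by
    have hnn : 0 ≤ ∏ p ∈ Q, (1 - (p : ℝ)⁻¹) ^ 2 := Finset.prod_nonneg fun _ _ => sq_nonneg _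
    by_cases h : 2 ∈ n.primeFactors
    · rw [← Finset.mul_prod_erase _ _ h]
      apply le_of_eq
      norm_num [Q]
    · rw [← Finset.erase_eq_of_notMem h]
      linarith
  have hpos : (0 : ℝ) < 2 * n.primeFactors.card + 1 := by positivity
  have hlow : 1 / (4 * (2 * (n.primeFactors.card : ℝ) + 1))
      ≤ ∏ p ∈ n.primeFactors, (1 - (p : ℝ)⁻¹) ^ 2 := by
    calc 1 / (4 * (2 * (n.primeFactors.card : ℝ) + 1))
        = 1 / 4 * (1 / (2 * (n.primeFactors.card : ℝ) + 1)) := by field_simp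
      _ ≤ 1 / 4 * (1 / (2 * (Q.card : ℝ) + 1)) := by gcongr
      _ ≤ _ := by linarith
  rw [htot, mul_pow, ← Finset.prod_pow]
  calc (n : ℝ) ^ 2 = 4 * (2 * (n.primeFactors.card : ℝ) + 1) *
        ((n : ℝ) ^ 2 * (1 / (4 * (2 * (n.primeFactors.card : ℝ) + 1)))) := by field_simp
    _ ≤ _ := by gcongr

/-- The kernel of multiplication by d consists of multiples of N/gcd(d, N), and every nonempty fibre
is a translate of it. -/
lemma card_mul_eq_le {N : ℕ} [NeZero N] (d e : ZMod N) :
    (Finset.univ.filter fun x : ZMod N => x * d = e).card ≤ Nat.gcd d.val N := by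
  classical
  have hN : 0 < N := NeZero.pos N
  set g := Nat.gcd d.val N with hg
  have hg0 : 0 < g := Nat.gcd_pos_of_pos_right _ hN
  have hgN : g ∣ N := Nat.gcd_dvd_right _ _
  have hm : 0 < N / g := Nat.div_pos (Nat.le_of_dvd hN hgN) hg0
  have hker : (Finset.univ.filter fun x : ZMod N => x * d = 0).card ≤ g := by
    have hdvd : ∀ x : ZMod N, x * d = 0 → N / g ∣ x.val := by
      intro x hx
      have h1 : N ∣ x.val * d.val := by
        rw [← ZMod.natCast_eq_zero_iff]
        simpa using hx
      have hco : Nat.Coprime (N / g) (d.val / g) := (Nat.coprime_div_gcd_div_gcd hg0).symm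
      refine hco.dvd_of_dvd_mul_right ?_
      have h2 : g * (N / g) ∣ g * (x.val * (d.val / g)) := by
        rw [Nat.mul_div_cancel' hgN, ← mul_assoc, mul_comm g, mul_assoc,
          Nat.mul_div_cancel' (Nat.gcd_dvd_left d.val N)]
        exact h1
      exact Nat.dvd_of_mul_dvd_mul_left hg0 h2
    rw [← Finset.card_range g]
    refine Finset.card_le_card_of_injOn (fun x => x.val / (N / g)) ?_ ?_
    · intro x hx
      simp only [Finset.coe_range, Set.mem_Iio]
      rw [Nat.div_lt_iff_lt_mul hm, Nat.mul_div_cancel' hgN]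
      exact x.val_lt
    · intro x hx y hy hxy
      have hx := hdvd x (by simpa using hx)
      have hy := hdvd y (by simpa using hy)
      apply ZMod.val_injective
      have hxy : x.val / (N / g) = y.val / (N / g) := hxy
      rw [← Nat.div_mul_cancel hx, ← Nat.div_mul_cancel hy, hxy]
  rcases (Finset.univ.filter fun x : ZMod N => x * d = e).eq_empty_or_nonempty with h | ⟨x₀, h₀⟩
  · rw [h]; simp
  · refine le_trans (Finset.card_le_card_of_injOn (fun x => x - x₀) ?_ ?_) hker
    · intro x hx
      have hx : x * d = e := by simpa using hx
      have h₀ : x₀ * d = e := by simpa using h₀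
      simp [sub_mul, hx, h₀]
    · intro x _ y _ h
      exact sub_left_injective h

/-- With g = gcd(d, N), the products are multiples of g, so at most 2(y/g) nonzero ones are small,
and each is attained at most g times. The factors g cancel, which makes the bound uniform in d. -/
lemma card_small_mul_le {N : ℕ} [NeZero N] (d : ZMod N) (y : ℕ) :
    (Finset.univ.filter fun x : ZMod N => x * d ≠ 0 ∧ (x * d).valMinAbs.natAbs < y).card
      ≤ 2 * y := by
  classical
  have hN : 0 < N := NeZero.pos N
  set g := Nat.gcd d.val N with hg
  have hg0 : 0 < g := Nat.gcd_pos_of_pos_right _ hN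
  have hgN : g ∣ N := Nat.gcd_dvd_right _ _
  set s := Finset.univ.filter fun x : ZMod N => x * d ≠ 0 ∧ (x * d).valMinAbs.natAbs < y
  have h1 : s.card ≤ g * (s.image fun x => x * d).card := by
    refine Finset.card_le_mul_card_image s g fun e _ => ?_
    refine le_trans (Finset.card_le_card ?_) (card_mul_eq_le d e)
    intro x hx
    simpa using (Finset.mem_filter.1 hx).2
  have hdvd : ∀ x : ZMod N, (g : ℤ) ∣ (x * d).valMinAbs := by
    intro x
    have hd : ((x * d).valMinAbs : ZMod N) = ((x.val * d.val : ℤ) : ZMod N) := by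
      push_cast
      simp
    rw [ZMod.intCast_eq_intCast_iff_dvd_sub] at hd
    have h2 : (g : ℤ) ∣ (x.val * d.val : ℤ) :=
      Dvd.dvd.mul_left (Int.natCast_dvd_natCast.2 (Nat.gcd_dvd_left _ _)) _
    have h3 := (Int.natCast_dvd_natCast.2 hgN).trans hd
    have := dvd_sub h2 h3
    simpa using this
  have h2 : (s.image fun x => x * d).card ≤ 2 * (y / g) := by
    have hsub : (s.image fun x => (x * d)).image ZMod.valMinAbs ⊆
        ((Finset.Icc 1 (y / g)).image fun m : ℕ => (g * m : ℤ)) ∪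
        ((Finset.Icc 1 (y / g)).image fun m : ℕ => (-(g * m) : ℤ)) := by
      intro z hz
      simp only [Finset.mem_image] at hz
      obtain ⟨_, ⟨x, hx, rfl⟩, rfl⟩ := hz
      obtain ⟨hx0, hxy⟩ := (Finset.mem_filter.1 hx).2
      have hz0 : (x * d).valMinAbs ≠ 0 := by simpa [ZMod.valMinAbs_eq_zero] using hx0
      have hgd : g ∣ (x * d).valMinAbs.natAbs := Int.natCast_dvd.1 (hdvd x)
      obtain ⟨m, hm⟩ := hgd
      have hm1 : m ∈ Finset.Icc 1 (y / g) := by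
        rw [Finset.mem_Icc]
        constructor
        · rcases Nat.eq_zero_or_pos m with rfl | h
          · simp at hm; exact absurd hm hx0
          · exact h
        · rw [Nat.le_div_iff_mul_le hg0, mul_comm, ← hm]; exact hxy.le
      rw [Finset.mem_union, Finset.mem_image, Finset.mem_image]
      rcases Int.natAbs_eq (x * d).valMinAbs with h | h
      · left; exact ⟨m, hm1, by rw [h, hm]; push_cast; rfl⟩
      · right; exact ⟨m, hm1, by rw [h, hm]; push_cast; rfl⟩
    rw [← Finset.card_image_of_injective _ ZMod.injective_valMinAbs]
    refine (Finset.card_le_card hsub).trans ((Finset.card_union_le _ _).trans ?_)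
    have e1 := Finset.card_image_le (s := Finset.Icc 1 (y / g)) (f := fun m : ℕ => (g * m : ℤ))
    have e2 := Finset.card_image_le (s := Finset.Icc 1 (y / g)) (f := fun m : ℕ => (-(g * m) : ℤ))
    rw [Nat.card_Icc] at e1 e2
    omega
  calc s.card ≤ g * (2 * (y / g)) := h1.trans (Nat.mul_le_mul_left _ h2)
    _ = 2 * (g * (y / g)) := by ring
    _ ≤ 2 * y := Nat.mul_le_mul_left _ (Nat.mul_div_le y g)

lemma card_units_small_mul_le {N : ℕ} [NeZero N] {d : ZMod N} (hd : d ≠ 0) (y : ℕ) :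
    (Finset.univ.filter fun σ : (ZMod N)ˣ => ((σ : ZMod N) * d).valMinAbs.natAbs < y).card
      ≤ 2 * y := by
  refine le_trans (Finset.card_le_card_of_injOn (fun σ => (σ : ZMod N)) ?_ ?_)
    (card_small_mul_le d y)
  · intro σ hσ
    have h : ((σ : ZMod N) * d).valMinAbs.natAbs < y := by simpa using hσ
    simpa [hd] using h
  · intro σ _ τ _ h
    exact Units.ext h

/-! ### The Dirichlet kernel -/

lemma stdAddChar_eq_exp {N : ℕ} [NeZero N] (m : ℤ) :
    ZMod.stdAddChar (m : ZMod N) = Complex.exp (Complex.I * (2 * Real.pi * m / N : ℝ)) := by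
  rw [ZMod.stdAddChar_coe]
  congr 1
  push_cast
  ring

/-- The frequency response of the averaging filter of length `B`. -/
def dirichlet {N : ℕ} [NeZero N] (B : ℕ) (f : ZMod N) : ℂ :=
  (B : ℂ)⁻¹ * ∑ l ∈ Finset.range B, ZMod.stdAddChar (-(f * (l : ZMod N)))

lemma norm_stdAddChar_sub_one_le {N : ℕ} [NeZero N] (m : ℤ) :
    ‖ZMod.stdAddChar (m : ZMod N) - 1‖ ≤ 2 * Real.pi * |(m : ℝ)| / N := by
  have hN : (0 : ℝ) < N := Nat.cast_pos.2 (NeZero.pos N)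
  rw [stdAddChar_eq_exp]
  refine (Real.norm_exp_I_mul_ofReal_sub_one_le).trans (le_of_eq ?_)
  rw [Real.norm_eq_abs, abs_div, abs_mul, abs_of_pos hN, abs_of_pos Real.two_pi_pos]

lemma norm_dirichlet_sub_one_le {N : ℕ} [NeZero N] {B : ℕ} (hB : 0 < B) (m : ℤ) :
    ‖dirichlet B (m : ZMod N) - 1‖ ≤ 2 * Real.pi * |(m : ℝ)| * B / N := by
  have hN : (0 : ℝ) < N := Nat.cast_pos.2 (NeZero.pos N)
  have hB' : (0 : ℝ) < B := Nat.cast_pos.2 hB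
  have hBc : (B : ℂ) ≠ 0 := Nat.cast_ne_zero.2 hB.ne'
  have h1 : dirichlet B (m : ZMod N) - 1 = (B : ℂ)⁻¹ *
      ∑ l ∈ Finset.range B, (ZMod.stdAddChar (-((m : ZMod N) * (l : ZMod N))) - 1) := by
    rw [Finset.sum_sub_distrib, mul_sub, dirichlet]
    simp [hBc]
  rw [h1, norm_mul, norm_inv, Complex.norm_natCast, inv_mul_le_iff₀ hB']
  calc ‖∑ l ∈ Finset.range B, (ZMod.stdAddChar (-((m : ZMod N) * (l : ZMod N))) - 1)‖
      ≤ ∑ l ∈ Finset.range B, 2 * Real.pi * |(m : ℝ)| * B / N := by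
        refine norm_sum_le_of_le _ fun l hl => ?_
        have e : -((m : ZMod N) * (l : ZMod N)) = ((-(m * l) : ℤ) : ZMod N) := by push_cast; rfl
        rw [e]
        refine (norm_stdAddChar_sub_one_le _).trans ?_
        have hl' : (l : ℝ) ≤ B := by exact_mod_cast (Finset.mem_range.1 hl).le
        push_cast
        rw [abs_neg, abs_mul, Nat.abs_cast, ← mul_assoc]
        gcongr
    _ = B * (2 * Real.pi * |(m : ℝ)| * B / N) := by simp

/-- The chord is 2|sin(π f/N)|, and Jordan's inequality applies because the centred representative
is at most N/2 in modulus. -/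
lemma le_norm_stdAddChar_sub_one {N : ℕ} [NeZero N] (f : ZMod N) :
    4 * (f.valMinAbs.natAbs : ℝ) / N ≤ ‖ZMod.stdAddChar f - 1‖ := by
  have hN : (0 : ℝ) < N := Nat.cast_pos.2 (NeZero.pos N)
  have hle : (f.valMinAbs.natAbs : ℝ) * 2 ≤ N := by
    have := f.natAbs_valMinAbs_le
    have : f.valMinAbs.natAbs * 2 ≤ N := by omega
    exact_mod_cast this
  have hcast : (f.valMinAbs.natAbs : ℝ) = |(f.valMinAbs : ℝ)| := by
    rw [← Int.cast_abs, Int.abs_eq_natAbs]; simp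
  conv_rhs => rw [← f.coe_valMinAbs]
  rw [stdAddChar_eq_exp, Complex.norm_exp_I_mul_ofReal_sub_one, Real.norm_eq_abs, abs_mul, abs_two]
  set v : ℝ := (f.valMinAbs.natAbs : ℝ) with hv
  have hv0 : 0 ≤ v := Nat.cast_nonneg _
  have hx : 2 * Real.pi * (f.valMinAbs : ℝ) / N / 2 = Real.pi / N * (f.valMinAbs : ℝ) := by ring
  have habs : |Real.sin (2 * Real.pi * (f.valMinAbs : ℝ) / N / 2)| ≥ Real.sin (Real.pi / N * v) := by
    rw [hx, hcast]
    rcases abs_cases (f.valMinAbs : ℝ) with ⟨h, -⟩ | ⟨h, -⟩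
    · rw [h]; exact le_abs_self _
    · rw [h, mul_neg, Real.sin_neg]; exact neg_le_abs _
  have hs : 2 / Real.pi * (Real.pi / N * v) ≤ Real.sin (Real.pi / N * v) := by
    refine Real.mul_le_sin (by positivity) ?_
    rw [div_mul_eq_mul_div, div_le_div_iff₀ hN two_pos]
    nlinarith [Real.pi_pos]
  have e : 2 / Real.pi * (Real.pi / N * v) = 2 * v / N := by
    field_simp
  rw [e] at hs
  calc 4 * v / N = 2 * (2 * v / N) := by ring
    _ ≤ _ := by gcongr; exact hs.trans habs

/-- The geometric sum has a numerator of modulus at most 2 and a denominator bounded below by the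
chord estimate. -/
lemma norm_dirichlet_le {N : ℕ} [NeZero N] {B : ℕ} (hB : 0 < B) {f : ZMod N} {v : ℝ} (hv : 0 < v)
    (hf : v ≤ f.valMinAbs.natAbs) : ‖dirichlet B f‖ ≤ N / (2 * B * v) := by
  have hN : (0 : ℝ) < N := Nat.cast_pos.2 (NeZero.pos N)
  have hB' : (0 : ℝ) < B := Nat.cast_pos.2 hB
  have hlow : 4 * v / N ≤ ‖ZMod.stdAddChar (-f) - 1‖ := by
    refine le_trans ?_ (le_norm_stdAddChar_sub_one (-f))
    rw [ZMod.natAbs_valMinAbs_neg]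
    gcongr
  have hpos : 0 < ‖ZMod.stdAddChar (-f) - 1‖ := lt_of_lt_of_le (by positivity) hlow
  have hne : ZMod.stdAddChar (-f) ≠ 1 := fun h => by simp [h] at hpos
  have hgeom : ∑ l ∈ Finset.range B, ZMod.stdAddChar (-(f * (l : ZMod N))) =
      (ZMod.stdAddChar (-f) ^ B - 1) / (ZMod.stdAddChar (-f) - 1) := by
    rw [← geom_sum_eq hne]
    refine Finset.sum_congr rfl fun l _ => ?_
    rw [← AddChar.map_nsmul_eq_pow]
    congr 1
    rw [nsmul_eq_mul]; ring
  rw [dirichlet, hgeom, norm_mul, norm_inv, Complex.norm_natCast, norm_div]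
  have hnum : ‖ZMod.stdAddChar (-f) ^ B - 1‖ ≤ 2 := by
    refine (norm_sub_le _ _).trans ?_
    rw [norm_pow, AddChar.norm_apply]
    norm_num
  calc (B : ℝ)⁻¹ * (‖ZMod.stdAddChar (-f) ^ B - 1‖ / ‖ZMod.stdAddChar (-f) - 1‖)
      ≤ (B : ℝ)⁻¹ * (2 / (4 * v / N)) := by gcongr
    _ = N / (2 * B * v) := by field_simp; norm_num

/-! ### Rounding errors -/

lemma round_le_round {x y : ℝ} (h : x ≤ y) : round x ≤ round y := by
  rw [round_eq, round_eq]
  gcongr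

lemma abs_roundReal_sub_le {b : ℕ} {x : ℝ} (hx : |x| ≤ 2 ^ b) :
    |roundReal b x - x| ≤ ((2 : ℝ) ^ b)⁻¹ / 2 := by
  have hp : (0 : ℝ) < 2 ^ b := by positivity
  obtain ⟨h1, h2⟩ := abs_le.1 hx
  -- Rounding is monotone and fixes the integer 4^b, so it cannot leave the range and saturation
  -- stays inactive.
  have hup : ((round ((2 : ℝ) ^ b * x) : ℤ) : ℝ) ≤ 2 ^ b * 2 ^ b := by
    have h3 : (2 : ℝ) ^ b * x ≤ ((2 ^ b * 2 ^ b : ℤ) : ℝ) := by push_cast; gcongr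
    have := round_le_round h3
    rw [round_intCast] at this
    exact_mod_cast this
  have hlo : -(2 ^ b * 2 ^ b) ≤ ((round ((2 : ℝ) ^ b * x) : ℤ) : ℝ) := by
    have h3 : ((-(2 ^ b * 2 ^ b) : ℤ) : ℝ) ≤ (2 : ℝ) ^ b * x := by push_cast; nlinarith
    have := round_le_round h3
    rw [round_intCast] at this
    exact_mod_cast this
  rw [roundReal, min_eq_right (by rwa [div_le_iff₀ hp]), max_eq_right (by
    rw [le_div_iff₀ hp]; linarith)]
  have h4 := abs_sub_round ((2 : ℝ) ^ b * x)
  have e : ((round ((2 : ℝ) ^ b * x) : ℤ) : ℝ) / 2 ^ b - x =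
      -((2 ^ b * x - (round ((2 : ℝ) ^ b * x) : ℤ)) * ((2 : ℝ) ^ b)⁻¹) := by
    field_simp
    ring
  rw [e, abs_neg, abs_mul, abs_of_pos (inv_pos.2 hp)]
  calc _ ≤ 1 / 2 * ((2 : ℝ) ^ b)⁻¹ := by gcongr
    _ = _ := by ring

lemma norm_rnd_sub_le {b : ℕ} {z : ℂ} (hz : ‖z‖ ≤ 2 ^ b) :
    ‖rnd b z - z‖ ≤ ((2 : ℝ) ^ b)⁻¹ := by
  refine (Complex.norm_le_abs_re_add_abs_im _).trans ?_
  have h1 := abs_roundReal_sub_le ((Complex.abs_re_le_norm z).trans hz)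
  have h2 := abs_roundReal_sub_le ((Complex.abs_im_le_norm z).trans hz)
  simp only [rnd, Complex.sub_re, Complex.sub_im]
  linarith

/-- The form in which errors propagate: z is the computed value, z' the ideal one, and the last
hypothesis excludes saturation. -/
lemma norm_rnd_sub_le' {b : ℕ} {z z' : ℂ} {e R : ℝ} (h : ‖z - z'‖ ≤ e) (hR : ‖z'‖ ≤ R)
    (hb : R + e ≤ 2 ^ b) : ‖rnd b z - z'‖ ≤ e + ((2 : ℝ) ^ b)⁻¹ := by
  have hz : ‖z‖ ≤ 2 ^ b := by
    have := norm_add_le (z - z') z'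
    rw [sub_add_cancel] at this
    linarith
  have := norm_add_le (rnd b z - z) (z - z')
  rw [sub_add_sub_cancel] at this
  linarith [norm_rnd_sub_le hz]

lemma norm_mul_sub_mul_le {x x' y y' : ℂ} {e₁ e₂ R₁ R₂ : ℝ} (hx : ‖x - x'‖ ≤ e₁)
    (hy : ‖y - y'‖ ≤ e₂) (hx' : ‖x'‖ ≤ R₁) (hy' : ‖y'‖ ≤ R₂) :
    ‖x * y - x' * y'‖ ≤ e₁ * (R₂ + e₂) + R₁ * e₂ := by
  have e : x * y - x' * y' = (x - x') * (y' + (y - y')) + x' * (y - y') := by ring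
  have h0 : 0 ≤ e₁ := (norm_nonneg _).trans hx
  have h1 : 0 ≤ R₁ := (norm_nonneg _).trans hx'
  rw [e]
  refine (norm_add_le _ _).trans ?_
  rw [norm_mul, norm_mul]
  gcongr
  exact (norm_add_le _ _).trans (add_le_add hy' hy)

lemma norm_rnd_mul_sub_le {b : ℕ} {x x' y y' : ℂ} {e₁ e₂ R₁ R₂ : ℝ} (hx : ‖x - x'‖ ≤ e₁)
    (hy : ‖y - y'‖ ≤ e₂) (hx' : ‖x'‖ ≤ R₁) (hy' : ‖y'‖ ≤ R₂)
    (hb : R₁ * R₂ + (e₁ * (R₂ + e₂) + R₁ * e₂) ≤ 2 ^ b) :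
    ‖rnd b (x * y) - x' * y'‖ ≤ e₁ * (R₂ + e₂) + R₁ * e₂ + ((2 : ℝ) ^ b)⁻¹ := by
  refine norm_rnd_sub_le' (norm_mul_sub_mul_le hx hy hx' hy') ?_ hb
  rw [norm_mul]
  have : 0 ≤ R₁ := (norm_nonneg _).trans hx'
  gcongr

lemma norm_foldl_rnd_sub_sum_le {ι : Type*} {b : ℕ} {e R : ℝ} (he : 0 ≤ e) (hR : 0 ≤ R)
    (f g : ι → ℂ) (l : List ι) (hfg : ∀ x ∈ l, ‖f x - g x‖ ≤ e) (hg : ∀ x ∈ l, ‖g x‖ ≤ R)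
    (hb : l.length * (R + e + ((2 : ℝ) ^ b)⁻¹) ≤ 2 ^ b) :
    ‖l.foldl (fun acc x => rnd b (acc + f x)) 0 - (l.map g).sum‖
      ≤ l.length * (e + ((2 : ℝ) ^ b)⁻¹) ∧ ‖(l.map g).sum‖ ≤ l.length * R := by
  have hp : (0 : ℝ) < ((2 : ℝ) ^ b)⁻¹ := by positivity
  -- A left fold ends with the last element of the list, so the induction appends on the right.
  induction l using List.reverseRecOn with
  | nil => simp
  | append_singleton l a ih =>
    simp only [List.length_append, List.length_singleton, Nat.cast_add, Nat.cast_one] at hb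
    obtain ⟨h1, h2⟩ := ih (fun x hx => hfg x (by simp [hx])) (fun x hx => hg x (by simp [hx]))
      (by nlinarith)
    have h3 := hfg a (by simp)
    have h4 := hg a (by simp)
    simp only [List.foldl_append, List.foldl_cons, List.foldl_nil, List.map_append, List.map_cons,
      List.map_nil, List.sum_append, List.sum_cons, List.sum_nil, add_zero, List.length_append,
      List.length_singleton, Nat.cast_add, Nat.cast_one]
    have h5 : ‖(l.map g).sum + g a‖ ≤ (l.length + 1) * R := by
      refine (norm_add_le _ _).trans ?_
      linarith
    refine ⟨?_, h5⟩
    refine (norm_rnd_sub_le' (e := l.length * (e + ((2 : ℝ) ^ b)⁻¹) + e) ?_ h5 ?_).trans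
      (le_of_eq (by ring))
    · rw [add_sub_add_comm]
      exact (norm_add_le _ _).trans (add_le_add h1 h3)
    · nlinarith

/-! ### Location by bisection -/

/-- The phase that turns the sign of the position relative to the centre of an interval of
length `M` into the sign of a real part. -/
def bisectPhase (N M : ℕ) : ℂ :=
  Complex.exp (((-(Real.pi / 2 + Real.pi * M * (N / (2 * M) : ℕ) / N) : ℝ) : ℂ) * Complex.I)

/-- One bisection step: index register `0` holds the left end of an interval of length `M`. -/
def bisectStep (N M : ℕ) : List (Instr N) :=
  [.idxConst 1 (N / (2 * M) : ℕ), .sample 1 1, .mul 1 1 0, .idxMul 2 0 1, .char 2 2, .conj 2 2,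
    .mul 1 1 2, .const 3 (bisectPhase N M), .mul 1 1 3, .idxConst 3 ((M + 3) / 4 : ℕ),
    .idxAdd 3 0 3, .idxSelect 0 1 4 0 3]

/-- `n` bisection steps that start with an interval of length `M`. -/
def bisect (N : ℕ) : ℕ → ℕ → List (Instr N)
  | 0, _ => []
  | n + 1, M => bisectStep N M ++ bisect N n (3 * M / 4)

/-- The positions at which `bisect` takes samples. -/
def bisectTimes (N : ℕ) : ℕ → ℕ → List (ZMod N)
  | 0, _ => []
  | n + 1, M => ((N / (2 * M) : ℕ) : ZMod N) :: bisectTimes N n (3 * M / 4)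

/-- Location of a frequency in `[-K, K]` by `n` bisection steps. -/
def locateProgram (N K n : ℕ) : List (Instr N) :=
  [.idxConst 0 (-(K : ZMod N)), .sample 0 1, .conj 0 0] ++ bisect N n (2 * K)

lemma length_bisectTimes (N n M : ℕ) : (bisectTimes N n M).length = n := by
  induction n generalizing M with
  | zero => rfl
  | succ n ih => simp [bisectTimes, ih]

lemma norm_bisectPhase (N M : ℕ) : ‖bisectPhase N M‖ = 1 :=
  Complex.norm_exp_ofReal_mul_I _

/-- The phase moves the origin to the midpoint M/2 of the interval and turns the cosine into a sine,
whose sign tells the side of the midpoint. -/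
lemma re_stdAddChar_mul_bisectPhase {N : ℕ} [NeZero N] (M δ : ℕ) :
    (ZMod.stdAddChar ((δ : ZMod N) * ((N / (2 * M) : ℕ) : ZMod N)) * bisectPhase N M).re =
      Real.sin (Real.pi * (N / (2 * M) : ℕ) * (2 * δ - M) / N) := by
  rw [bisectPhase]
  generalize N / (2 * M) = t
  have e : (δ : ZMod N) * (t : ZMod N) = ((δ * t : ℤ) : ZMod N) := by push_cast; rfl
  rw [e, stdAddChar_eq_exp, mul_comm Complex.I, ← Complex.exp_add, ← add_mul,
    ← Complex.ofReal_add, Complex.exp_ofReal_mul_I_re, ← Real.cos_sub_pi_div_two]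
  congr 1
  push_cast
  ring

lemma quarter_le_sin {x : ℝ} (h1 : Real.pi / 8 ≤ x) (h2 : x ≤ Real.pi / 2) :
    1 / 4 ≤ Real.sin x := by
  have h := Real.mul_le_sin (by linarith [Real.pi_pos]) h2
  refine le_trans ?_ h
  rw [div_mul_eq_mul_div, div_le_div_iff₀ (by norm_num) Real.pi_pos]
  linarith

/-- Rounding N/(2M) down costs at most a factor 2, because the quotient is at least 1. -/
lemma bisect_time_bounds {N M : ℕ} (hM : 0 < M) (hMN : 2 * M ≤ N) :
    N ≤ 4 * ((N / (2 * M)) * M) ∧ 2 * ((N / (2 * M)) * M) ≤ N := by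
  have h1 := Nat.div_add_mod N (2 * M)
  have h2 := Nat.mod_lt N (show 0 < 2 * M by omega)
  have h3 : 1 ≤ N / (2 * M) := by rw [Nat.one_le_div_iff (by omega)]; exact hMN
  have h4 : M ≤ (N / (2 * M)) * M := Nat.le_mul_of_pos_left _ h3
  have h5 : 2 * M * (N / (2 * M)) = 2 * ((N / (2 * M)) * M) := by ring
  omega

/-- In the last quarter 2δ - M lies between M/2 and M, which puts the angle between π/8 and π/2. -/
lemma sin_bisect_of_lt {N M δ : ℕ} (hM : 0 < M) (hMN : 2 * M ≤ N) (hδ : δ ≤ M)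
    (h : 3 * M < 4 * δ) :
    1 / 4 ≤ Real.sin (Real.pi * (N / (2 * M) : ℕ) * (2 * δ - M) / N) := by
  obtain ⟨h1, h2⟩ := bisect_time_bounds hM hMN
  have hN : (0 : ℝ) < N := by exact_mod_cast (show 0 < N by omega)
  set t := N / (2 * M)
  have h1' : (N : ℝ) ≤ 4 * (t * M) := by exact_mod_cast h1
  have h2' : 2 * ((t : ℝ) * M) ≤ N := by exact_mod_cast h2
  have h3 : (3 * M : ℝ) ≤ 4 * δ := by exact_mod_cast h.le
  have h4 : (δ : ℝ) ≤ M := by exact_mod_cast hδ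
  have ht : (0 : ℝ) ≤ t := Nat.cast_nonneg _
  have e : Real.pi * t * (2 * δ - M) / N = Real.pi * (t * (2 * δ - M) / N) := by ring
  have u1 : 1 / 8 ≤ (t : ℝ) * (2 * δ - M) / N := by
    rw [le_div_iff₀ hN]; nlinarith
  have u2 : (t : ℝ) * (2 * δ - M) / N ≤ 1 / 2 := by
    rw [div_le_iff₀ hN]; nlinarith
  rw [e]
  exact quarter_le_sin (by nlinarith [Real.pi_pos]) (by nlinarith [Real.pi_pos])

lemma sin_bisect_of_gt {N M δ : ℕ} (hM : 0 < M) (hMN : 2 * M ≤ N) (hδ : δ ≤ M)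
    (h : 4 * δ < M) :
    Real.sin (Real.pi * (N / (2 * M) : ℕ) * (2 * δ - M) / N) ≤ -(1 / 4) := by
  -- The first quarter is the mirror image of the last one.
  have := sin_bisect_of_lt (δ := M - δ) hM hMN (by omega) (by omega)
  rw [Nat.cast_sub hδ] at this
  have e : Real.pi * (N / (2 * M) : ℕ) * (2 * δ - M) / N =
    -(Real.pi * (N / (2 * M) : ℕ) * (2 * ((M : ℝ) - δ) - M) / N) := by ring
  rw [e, Real.sin_neg]
  linarith

/-- The complex number on which a bisection step decides. -/
def bisectTest {N : ℕ} [NeZero N] (b : ℕ) (x₀ x : ℂ) (w : ZMod N) (M : ℕ) : ℂ :=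
  rnd b (rnd b (rnd b (rnd b x * x₀) * rnd b (starRingEnd ℂ (rnd b
    (ZMod.stdAddChar (w * ((N / (2 * M) : ℕ) : ZMod N)))))) * rnd b (bisectPhase N M))

/-- No instruction of the step writes complex register 4, so the selection compares the real part of
the test with zero. Register 0 keeps the reference value for all steps. -/
lemma foldl_bisectStep {N n : ℕ} [NeZero N] (b : ℕ) (X : ZMod N → ℂ) (u : Fin n → ZMod N)
    (M : ℕ) (s : RegState N) (h4 : s.val 4 = 0) :
    let s' := (bisectStep N M).foldl (fun s i => i.exec b X u s) s
    s'.val 0 = s.val 0 ∧ s'.val 4 = 0 ∧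
      ((bisectTest b (s.val 0) (X ((N / (2 * M) : ℕ) : ZMod N)) (s.idx 0) M).re ≤ 0 →
        s'.idx 0 = s.idx 0) ∧
      (0 < (bisectTest b (s.val 0) (X ((N / (2 * M) : ℕ) : ZMod N)) (s.idx 0) M).re →
        s'.idx 0 = s.idx 0 + ((M + 3) / 4 : ℕ)) := by
  simp only [bisectStep, List.foldl_cons, List.foldl_nil, Instr.exec, RegState.setIdx,
    RegState.setVal, bisectTest]
  refine ⟨by simp, by simp [h4], fun h => ?_, fun h => ?_⟩
  · simp [Function.update, h4, h]
  · simp [Function.update, h4, not_le.2 h]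

/-- Multiplying by the conjugate of γ removes its unknown phase. The tolerance |γ|²/4 is what the
sine bound 1/4 on the outer quarters of the interval permits. -/
lemma norm_bisectTest_sub_lt {N : ℕ} [NeZero N] {b : ℕ} {x₀ x γ : ℂ} {w f : ZMod N} {M : ℕ} {e : ℝ}
    (hg : 0 < ‖γ‖) (hg1 : ‖γ‖ ≤ 1 / 2) (hη : 200 * ((2 : ℝ) ^ b)⁻¹ ≤ ‖γ‖ ^ 2)
    (he : e + 2 * ((2 : ℝ) ^ b)⁻¹ ≤ ‖γ‖ / 32)
    (hx₀ : ‖x₀ - starRingEnd ℂ γ‖ ≤ e + 2 * ((2 : ℝ) ^ b)⁻¹)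
    (hx : ‖x - γ * ZMod.stdAddChar (f * ((N / (2 * M) : ℕ) : ZMod N))‖ ≤ e) :
    ‖bisectTest b x₀ x w M - (‖γ‖ : ℂ) ^ 2 *
      (ZMod.stdAddChar ((f - w) * ((N / (2 * M) : ℕ) : ZMod N)) * bisectPhase N M)‖
        < ‖γ‖ ^ 2 / 4 := by
  set η : ℝ := ((2 : ℝ) ^ b)⁻¹ with hηdef
  set t : ZMod N := ((N / (2 * M) : ℕ) : ZMod N)
  set g : ℝ := ‖γ‖ with hgdef
  have hη0 : 0 < η := by positivity
  have he0 : 0 ≤ e := (norm_nonneg _).trans hx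
  have hη1 : η ≤ 1 / 800 := by nlinarith
  have h2b : (2 : ℝ) ^ b = η⁻¹ := by rw [hηdef, inv_inv]
  have hbig : (800 : ℝ) ≤ 2 ^ b := by
    rw [h2b, le_inv_comm₀ (by norm_num) hη0]; linarith
  have h1 : ‖γ * ZMod.stdAddChar (f * t)‖ ≤ g := by rw [norm_mul, AddChar.norm_apply, mul_one]
  have h2 : ‖rnd b x - γ * ZMod.stdAddChar (f * t)‖ ≤ e + 2 * η :=
    (norm_rnd_sub_le' hx h1 (by linarith)).trans (by linarith)
  have h3 : ‖starRingEnd ℂ γ‖ ≤ g := by rw [RCLike.norm_conj]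
  set E := e + 2 * η
  have hE0 : 0 < E := by positivity
  have h4 := norm_rnd_mul_sub_le (b := b) h2 hx₀ h1 h3 (by nlinarith)
  have h5 : ‖rnd b (ZMod.stdAddChar (w * t)) - ZMod.stdAddChar (w * t)‖ ≤ η :=
    norm_rnd_sub_le (by rw [AddChar.norm_apply]; linarith)
  have h6 : ‖rnd b (starRingEnd ℂ (rnd b (ZMod.stdAddChar (w * t)))) -
      ZMod.stdAddChar (-(w * t))‖ ≤ 2 * η := by
    refine (norm_rnd_sub_le' (e := η) (R := 1) ?_ ?_ (by linarith)).trans (by linarith)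
    · rw [AddChar.map_neg_eq_conj, ← map_sub, RCLike.norm_conj]
      exact h5
    · rw [AddChar.norm_apply]
  have hn : ‖ZMod.stdAddChar (-(w * t))‖ ≤ 1 := by rw [AddChar.norm_apply]
  have h7 : ‖γ * ZMod.stdAddChar (f * t) * starRingEnd ℂ γ‖ ≤ g ^ 2 := by
    rw [norm_mul, sq]
    gcongr
  set p := E * (g + E) + g * E + η
  have hp0 : 0 < p := by positivity
  -- From E ≤ g/32 and η ≤ g²/200: 1/16 + 1/1024 + 1/200 < 1/14.
  have hp : p ≤ g ^ 2 / 14 := by nlinarith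
  have h8 := norm_rnd_mul_sub_le (b := b) h4 h6 h7 hn (by nlinarith)
  set Q := p * (1 + 2 * η) + g ^ 2 * (2 * η) + η
  have hg2 : g ^ 2 ≤ 1 / 4 := by nlinarith
  have hpη : p * η ≤ g ^ 2 / 14 * (1 / 800) := by gcongr
  have hgη : g ^ 2 * η ≤ g ^ 2 * (1 / 800) := by gcongr
  have hQ : Q ≤ g ^ 2 / 10 := by
    simp only [Q]
    linarith
  have hQ0 : 0 < Q := by positivity
  have hQη : Q * η ≤ g ^ 2 / 10 * (1 / 800) := by gcongr
  have h9 : ‖rnd b (bisectPhase N M) - bisectPhase N M‖ ≤ η :=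
    norm_rnd_sub_le (by rw [norm_bisectPhase]; linarith)
  have h10 : ‖γ * ZMod.stdAddChar (f * t) * starRingEnd ℂ γ * ZMod.stdAddChar (-(w * t))‖
      ≤ g ^ 2 := by
    rw [norm_mul, AddChar.norm_apply, mul_one]
    exact h7
  have h11 := norm_rnd_mul_sub_le (b := b) (e₁ := Q) h8 h9 h10 (norm_bisectPhase N M).le (by linarith)
  have e1 : γ * ZMod.stdAddChar (f * t) * starRingEnd ℂ γ * ZMod.stdAddChar (-(w * t)) *
      bisectPhase N M = (g : ℂ) ^ 2 * (ZMod.stdAddChar ((f - w) * t) * bisectPhase N M) := by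
    rw [sub_mul, sub_eq_add_neg, AddChar.map_add_eq_mul, ← Complex.mul_conj']
    ring
  rw [e1] at h11
  refine lt_of_le_of_lt h11 ?_
  have hg0 : 0 < g ^ 2 := by positivity
  linarith

/-- A step discards only an outer quarter of the interval, and never the one containing f. In the
middle half the sign of the test may be wrong, but either choice keeps f. -/
lemma bisect_correct {N n : ℕ} [NeZero N] {b : ℕ} {X : ZMod N → ℂ} (u : Fin n → ZMod N) {γ : ℂ}
    {f : ZMod N} {e : ℝ} (hg : 0 < ‖γ‖) (hg1 : ‖γ‖ ≤ 1 / 2) (hη : 200 * ((2 : ℝ) ^ b)⁻¹ ≤ ‖γ‖ ^ 2)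
    (he : e + 2 * ((2 : ℝ) ^ b)⁻¹ ≤ ‖γ‖ / 32) (m : ℕ) :
    ∀ (M : ℕ) (s : RegState N), 2 * M ≤ N → M < 2 ^ m →
      (∀ t ∈ bisectTimes N (3 * m) M, ‖X t - γ * ZMod.stdAddChar (f * t)‖ ≤ e) →
      ‖s.val 0 - starRingEnd ℂ γ‖ ≤ e + 2 * ((2 : ℝ) ^ b)⁻¹ → s.val 4 = 0 →
      (∃ δ ≤ M, f = s.idx 0 + (δ : ZMod N)) →
      ((bisect N (3 * m) M).foldl (fun s i => i.exec b X u s) s).idx 0 = f := by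
  have step : ∀ (M : ℕ) (s : RegState N), 2 * M ≤ N →
      ‖X ((N / (2 * M) : ℕ) : ZMod N) - γ * ZMod.stdAddChar (f * ((N / (2 * M) : ℕ) : ZMod N))‖ ≤ e →
      ‖s.val 0 - starRingEnd ℂ γ‖ ≤ e + 2 * ((2 : ℝ) ^ b)⁻¹ → s.val 4 = 0 →
      (∃ δ ≤ M, f = s.idx 0 + (δ : ZMod N)) →
      let s' := (bisectStep N M).foldl (fun s i => i.exec b X u s) s
      s'.val 0 = s.val 0 ∧ s'.val 4 = 0 ∧ ∃ δ ≤ 3 * M / 4, f = s'.idx 0 + (δ : ZMod N) := by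
    intro M s hM hX hs h4 ⟨δ, hδ, hf⟩
    obtain ⟨h0, h4', hle, hlt⟩ := foldl_bisectStep b X u M s h4
    refine ⟨h0, h4', ?_⟩
    have htest := norm_bisectTest_sub_lt (w := s.idx 0) hg hg1 hη he hs hX
    set v := bisectTest b (s.val 0) (X ((N / (2 * M) : ℕ) : ZMod N)) (s.idx 0) M
    have hre := lt_of_le_of_lt (Complex.abs_re_le_norm _) htest
    rw [hf, add_sub_cancel_left, Complex.sub_re, ← Complex.ofReal_pow, Complex.re_ofReal_mul,
      re_stdAddChar_mul_bisectPhase, abs_lt] at hre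
    obtain ⟨hre1, hre2⟩ := hre
    have hg2 : 0 < ‖γ‖ ^ 2 := by positivity
    rcases le_or_gt v.re 0 with hv | hv
    · rw [hle hv]
      refine ⟨δ, ?_, hf⟩
      by_contra hcon
      -- In the last quarter the test would have been positive.
      have hs := sin_bisect_of_lt (by omega) hM hδ (show 3 * M < 4 * δ by omega)
      nlinarith
    · rw [hlt hv]
      have hge : (M + 3) / 4 ≤ δ := by
        by_contra hcon
        have hs := sin_bisect_of_gt (by omega) hM hδ (show 4 * δ < M by omega)
        nlinarith
      -- The left end advances by ⌈M/4⌉, and M - ⌈M/4⌉ = ⌊3M/4⌋ is the new length.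
      refine ⟨δ - (M + 3) / 4, by omega, ?_⟩
      rw [hf, Nat.cast_sub hge]
      ring
  have steps : ∀ (l M : ℕ) (s : RegState N), 2 * M ≤ N →
      (∀ t ∈ bisectTimes N l M, ‖X t - γ * ZMod.stdAddChar (f * t)‖ ≤ e) →
      ‖s.val 0 - starRingEnd ℂ γ‖ ≤ e + 2 * ((2 : ℝ) ^ b)⁻¹ → s.val 4 = 0 →
      (∃ δ ≤ M, f = s.idx 0 + (δ : ZMod N)) →
      ∃ δ ≤ (fun M => 3 * M / 4)^[l] M,
        f = ((bisect N l M).foldl (fun s i => i.exec b X u s) s).idx 0 + (δ : ZMod N) := by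
    intro l
    induction l with
    | zero => intro M s _ _ _ _ h; exact h
    | succ l ih =>
      intro M s hM hX hs h4 hδ
      obtain ⟨h0, h4', h⟩ := step M s hM (hX _ (by simp [bisectTimes])) hs h4 hδ
      rw [bisect, List.foldl_append, Function.iterate_succ_apply]
      exact ih _ _ (by omega) (fun t ht => hX t (by simp [bisectTimes, ht])) (by rwa [h0]) h4' h
  -- Three steps at least halve the length, since (3/4)³ = 27/64 < 1/2. Length 0 leaves a single
  -- candidate.
  have hiter : ∀ m M : ℕ, M < 2 ^ m → (fun M => 3 * M / 4)^[3 * m] M = 0 := by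
    intro m
    induction m with
    | zero => intro M h; simpa using h
    | succ m ih =>
      intro M h
      rw [mul_add, mul_one, Function.iterate_add_apply]
      apply ih
      simp only [Function.iterate_succ, Function.iterate_zero, Function.comp_apply, id]
      rw [pow_succ] at h
      omega
  intro M s hM hm hX hs h4 hδ
  obtain ⟨δ, hδ', hf⟩ := steps (3 * m) M s hM hX hs h4 hδ
  rw [hiter m M hm, Nat.le_zero] at hδ'
  rw [hδ', Nat.cast_zero, add_zero] at hf
  exact hf.symm

/-- The sample at 0 approximates γ itself; its conjugate is the phase reference of all bisection
steps. -/
lemma runProgram_locateProgram {N n : ℕ} [NeZero N] {b : ℕ} {X : ZMod N → ℂ} (u : Fin n → ZMod N)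
    {γ : ℂ} {f : ZMod N} {e : ℝ} {K m : ℕ} (hg : 0 < ‖γ‖) (hg1 : ‖γ‖ ≤ 1 / 2)
    (hη : 200 * ((2 : ℝ) ^ b)⁻¹ ≤ ‖γ‖ ^ 2) (he : e + 2 * ((2 : ℝ) ^ b)⁻¹ ≤ ‖γ‖ / 32)
    (hK : 4 * K ≤ N) (hm : 2 * K < 2 ^ m) (hX₀ : ‖X 0 - γ‖ ≤ e)
    (hX : ∀ t ∈ bisectTimes N (3 * m) (2 * K), ‖X t - γ * ZMod.stdAddChar (f * t)‖ ≤ e)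
    (hf : ∃ δ ≤ 2 * K, f = -(K : ZMod N) + (δ : ZMod N)) :
    (runProgram b X u (locateProgram N K (3 * m))).idx 0 = f := by
  rw [runProgram, locateProgram, List.foldl_append]
  refine bisect_correct u hg hg1 hη he m (2 * K) _ (by omega) hm hX ?_ ?_ ?_
  · have hη0 : 0 < ((2 : ℝ) ^ b)⁻¹ := by positivity
    have he0 : 0 ≤ e := (norm_nonneg _).trans hX₀
    have hη1 : ((2 : ℝ) ^ b)⁻¹ ≤ 1 / 800 := by nlinarith
    have hbig : (800 : ℝ) ≤ 2 ^ b := by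
      rw [← inv_inv ((2 : ℝ) ^ b), le_inv_comm₀ (by norm_num) hη0]; linarith
    have h1 := norm_rnd_sub_le' (b := b) hX₀ (R := 1) (by linarith) (by linarith)
    have h2 : ‖rnd b (starRingEnd ℂ (rnd b (X 0))) - starRingEnd ℂ γ‖ ≤
        e + ((2 : ℝ) ^ b)⁻¹ + ((2 : ℝ) ^ b)⁻¹ := by
      refine norm_rnd_sub_le' (R := 1) ?_ ?_ (by linarith)
      · rw [← map_sub, RCLike.norm_conj]; exact h1
      · rw [RCLike.norm_conj]; linarith
    simp only [List.foldl_cons, List.foldl_nil, Instr.exec, RegState.setIdx, RegState.setVal,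
      RegState.init, Function.update_self]
    simp only [Function.update, one_ne_zero, dite_false]
    linarith
  · simp [Instr.exec, RegState.setIdx, RegState.setVal, RegState.init]
  · simpa [Instr.exec, RegState.setIdx, RegState.setVal, RegState.init] using hf

/-! ### The implementation with an averaging filter -/

/-- The averaging filter of length `B`. -/
def boxFilter (N B : ℕ) (τ : ZMod N) : ℂ := if τ.val < B then (B : ℂ)⁻¹ else 0

lemma card_val_lt_le (N B : ℕ) [NeZero N] :
    (Finset.univ.filter fun τ : ZMod N => τ.val < B).card ≤ B := by
  rw [← Finset.card_range B]
  refine Finset.card_le_card_of_injOn ZMod.val ?_ fun x _ y _ h => ZMod.val_injective N h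
  intro x hx
  simpa using hx

lemma boxFilter_gain_le {N : ℕ} [NeZero N] (B : ℕ) (ω : ZMod N) :
    ‖∑ τ, boxFilter N B τ * ZMod.stdAddChar (-(ω * τ))‖ ≤ 1 := by
  calc ‖∑ τ, boxFilter N B τ * ZMod.stdAddChar (-(ω * τ))‖
      ≤ ∑ τ : ZMod N, if τ.val < B then (B : ℝ)⁻¹ else 0 := by
        refine norm_sum_le_of_le _ fun τ _ => ?_
        rw [norm_mul, AddChar.norm_apply, mul_one, boxFilter]
        split_ifs <;> simp
    _ = (Finset.univ.filter fun τ : ZMod N => τ.val < B).card * (B : ℝ)⁻¹ := by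
        rw [← Finset.sum_filter, Finset.sum_const, nsmul_eq_mul]
    _ ≤ B * (B : ℝ)⁻¹ := by
        gcongr
        exact card_val_lt_le N B
    _ ≤ 1 := mul_inv_le_one

/-- The implementation with the averaging filter of length `B`, a single interval, location by
bisection in `[-K, K]`, and one sample for the coefficient. -/
def boxImpl (N : ℕ) [NeZero N] (nPerm B K m b : ℕ) : SFFTImpl N where
  nPerm := nPerm
  nInt := 1
  nSeed := 0
  nThr := 1
  prec := b
  F := boxFilter N B
  gain_le := boxFilter_gain_le B
  locate := locateProgram N K (3 * m)

section BoxImpl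

variable {N : ℕ} [NeZero N] {nPerm B K m b : ℕ}

lemma support_boxImpl (hB : 0 < B) :
    (boxImpl N nPerm B K m b).support = Finset.univ.filter fun τ : ZMod N => τ.val < B := by
  ext τ
  simp [SFFTImpl.support, boxImpl, boxFilter, hB.ne']

lemma nF_boxImpl_le : (boxImpl N nPerm B K m b).nF ≤ B := by
  refine le_trans (Finset.card_le_card ?_) (card_val_lt_le N B)
  intro τ
  simp only [SFFTImpl.support, boxImpl, boxFilter, Finset.mem_filter, Finset.mem_univ, true_and]
  intro h
  by_contra h'
  simp [h'] at h

lemma sum_support_boxImpl (hB : 0 < B) (hBN : B ≤ N) (h : ZMod N → ℂ) :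
    ∑ τ ∈ (boxImpl N nPerm B K m b).support, h τ = ∑ l ∈ Finset.range B, h (l : ZMod N) := by
  rw [support_boxImpl hB]
  refine Finset.sum_nbij' ZMod.val (fun l => (l : ZMod N)) ?_ ?_ ?_ ?_ ?_
  · intro τ hτ; simpa using hτ
  · intro l hl
    have hl := Finset.mem_range.1 hl
    simpa [ZMod.val_cast_of_lt (hl.trans_le hBN)] using hl
  · intro τ _; simp
  · intro l hl
    exact ZMod.val_cast_of_lt ((Finset.mem_range.1 hl).trans_le hBN)
  · intro τ _; simp

lemma shift_boxImpl (j : Fin (boxImpl N nPerm B K m b).nInt) :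
    (boxImpl N nPerm B K m b).shift j = 0 := by
  have : j.val = 0 := by
    have := j.2
    have h : (boxImpl N nPerm B K m b).nInt = 1 := rfl
    omega
  simp [SFFTImpl.shift, this]

/-- The average of the permuted and modulated noise over the window of the filter. -/
def noiseSum (B : ℕ) (ν : ZMod N → ℂ) (σ : (ZMod N)ˣ) (a τ : ZMod N) : ℂ :=
  ∑ l ∈ Finset.range B, ZMod.stdAddChar (a * (τ - (l : ZMod N))) * ν (σ * (τ - (l : ZMod N)))

lemma norm_expVec (ω τ : ZMod N) : ‖expVec ω τ‖ = 1 / Real.sqrt N := by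
  rw [expVec, norm_div, AddChar.norm_apply, Complex.norm_real, Real.norm_of_nonneg (Real.sqrt_nonneg _)]

/-- Dilation by σ and modulation by a move the frequency ω to σω + a, and averaging over the window
multiplies its coefficient by the Dirichlet kernel there. -/
lemma sum_box_signal {k : ℕ} (ω : Fin k → ZMod N) (α : EuclideanSpace ℂ (Fin k)) (ν : ZMod N → ℂ)
    (σ : (ZMod N)ˣ) (a τ : ZMod N) :
    ∑ l ∈ Finset.range B, (B : ℂ)⁻¹ * ZMod.stdAddChar (a * (τ - (l : ZMod N))) *
        signal ω α ν (σ * (τ - (l : ZMod N))) =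
      ∑ i, α i * dirichlet B ((σ : ZMod N) * ω i + a) * expVec ((σ : ZMod N) * ω i + a) τ +
        (B : ℂ)⁻¹ * noiseSum B ν σ a τ := by
  simp only [signal, mul_add, Finset.sum_add_distrib, noiseSum, Finset.mul_sum]
  congr 1
  · rw [Finset.sum_comm]
    refine Finset.sum_congr rfl fun i _ => ?_
    rw [dirichlet, Finset.mul_sum, Finset.mul_sum, Finset.sum_mul]
    refine Finset.sum_congr rfl fun l _ => ?_
    have e : ZMod.stdAddChar (a * (τ - (l : ZMod N))) *
        ZMod.stdAddChar (ω i * ((σ : ZMod N) * (τ - (l : ZMod N)))) =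
        ZMod.stdAddChar (-(((σ : ZMod N) * ω i + a) * (l : ZMod N))) *
          ZMod.stdAddChar (((σ : ZMod N) * ω i + a) * τ) := by
      rw [← AddChar.map_add_eq_mul, ← AddChar.map_add_eq_mul]
      congr 1
      ring
    simp only [expVec]
    calc _ = (B : ℂ)⁻¹ * (α i) / (Real.sqrt N : ℂ) * (ZMod.stdAddChar (a * (τ - (l : ZMod N))) *
        ZMod.stdAddChar (ω i * ((σ : ZMod N) * (τ - (l : ZMod N))))) := by ring
      _ = _ := by rw [e]; ring
  · refine Finset.sum_congr rfl fun l _ => by ring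

lemma norm_filtered_sub_sum_le (hB : 0 < B) (hBN : B ≤ N) (hb : 16 * (B : ℝ) ≤ 2 ^ b)
    (S : ZMod N → ℂ) (σ : (ZMod N)ˣ) (a τ : ZMod N)
    (hS : ∀ l < B, ‖S (σ * (τ - (l : ZMod N)))‖ ≤ 2) :
    ‖(boxImpl N nPerm B K m b).filtered S σ a 0 τ -
      ∑ l ∈ Finset.range B, (B : ℂ)⁻¹ * ZMod.stdAddChar (a * (τ - (l : ZMod N))) *
        S (σ * (τ - (l : ZMod N)))‖ ≤ 12 * B * ((2 : ℝ) ^ b)⁻¹ := by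
  set I := boxImpl N nPerm B K m b
  set η : ℝ := ((2 : ℝ) ^ b)⁻¹ with hη
  have hη0 : 0 < η := by positivity
  have hB1 : (1 : ℝ) ≤ B := by exact_mod_cast hB
  have h16 : (16 : ℝ) ≤ 2 ^ b := by linarith
  have hη1 : η ≤ 1 / 16 := by
    rw [hη, inv_le_comm₀ (by positivity) (by norm_num)]
    linarith
  have hF : ∀ τ' ∈ I.support, I.F τ' = (B : ℂ)⁻¹ := by
    intro τ' h
    rw [support_boxImpl hB, Finset.mem_filter] at h
    exact if_pos h.2
  rw [← sum_support_boxImpl (nPerm := nPerm) (K := K) (m := m) (b := b) hB hBN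
    fun τ' => (B : ℂ)⁻¹ * ZMod.stdAddChar (a * (τ - τ')) * S (σ * (τ - τ'))]
  set g : ZMod N → ℂ := fun τ' => (B : ℂ)⁻¹ * ZMod.stdAddChar (a * (τ - τ')) * S (σ * (τ - τ'))
  have hBinv : ‖(B : ℂ)⁻¹‖ ≤ 1 := by
    rw [norm_inv, Complex.norm_natCast]
    exact inv_le_one_of_one_le₀ hB1
  have hlen : (I.support.toList.length : ℝ) ≤ B := by
    rw [Finset.length_toList]
    exact_mod_cast nF_boxImpl_le
  have hSsup : ∀ τ' ∈ I.support, ‖S (σ * (τ - τ'))‖ ≤ 2 := by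
    intro τ' h
    rw [support_boxImpl hB, Finset.mem_filter] at h
    have := hS τ'.val h.2
    simpa using this
  have hc : ∀ τ', ‖(B : ℂ)⁻¹ * ZMod.stdAddChar (a * (τ - τ'))‖ ≤ 1 := by
    intro τ'
    rw [norm_mul, AddChar.norm_apply, mul_one]
    exact hBinv
  -- The first product has error at most 4η; times a sample of modulus at most 2 it gives 4η(2 + η)
  -- + 2η ≤ 11η. Rounding the accumulator adds one more η per term.
  have key := norm_foldl_rnd_sub_sum_le (b := b) (e := 11 * η) (R := 2) (by positivity) (by norm_num)
    (fun τ' => rnd b (rnd b (rnd b (I.F τ') * rnd b (ZMod.stdAddChar (0 * τ' + a * (τ - τ'))))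
        * rnd b (S (σ * (τ - τ'))))) g I.support.toList ?_ ?_ ?_
  · rw [Finset.sum_map_toList] at key
    refine key.1.trans ?_
    calc _ ≤ (B : ℝ) * (11 * η + η) := by gcongr
      _ = _ := by ring
  · intro τ' h
    rw [Finset.mem_toList] at h
    simp only [hF τ' h, zero_mul, zero_add, g]
    have h1 : ‖rnd b (B : ℂ)⁻¹ - (B : ℂ)⁻¹‖ ≤ η := norm_rnd_sub_le (by linarith)
    have h2 : ‖rnd b (ZMod.stdAddChar (a * (τ - τ'))) - ZMod.stdAddChar (a * (τ - τ'))‖ ≤ η :=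
      norm_rnd_sub_le (by rw [AddChar.norm_apply]; linarith)
    have h3 : ‖rnd b (S (σ * (τ - τ'))) - S (σ * (τ - τ'))‖ ≤ η :=
      norm_rnd_sub_le (by linarith [hSsup τ' h])
    have h4 := norm_rnd_mul_sub_le (b := b) h1 h2 hBinv (AddChar.norm_apply _ _).le (by nlinarith)
    have h4' : _ ≤ 4 * η := h4.trans (by nlinarith)
    have h5 := norm_rnd_mul_sub_le (b := b) h4' h3 (hc τ') (hSsup τ' h) (by nlinarith)
    exact h5.trans (by nlinarith)
  · intro τ' h
    rw [Finset.mem_toList] at h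
    simp only [g]
    rw [norm_mul]
    calc _ ≤ 1 * (2 : ℝ) := by gcongr; exacts [hc τ', hSsup τ' h]
      _ = 2 := by norm_num
  · calc _ ≤ (B : ℝ) * (2 + 11 * η + η) := by gcongr
      _ ≤ _ := by nlinarith

/-- The three terms of the bound are rounding, leakage from the other frequencies and averaged
noise. -/
lemma norm_filtered_signal_sub_le {k : ℕ} (hB : 0 < B) (hBN : B ≤ N) (hb : 16 * (B : ℝ) ≤ 2 ^ b)
    {ω : Fin k → ZMod N} {α : EuclideanSpace ℂ (Fin k)} {ν : ZMod N → ℂ} {a₀ v r : ℝ}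
    (hα : ∀ i, ‖α i‖ ≤ a₀) (ha₀ : k * a₀ ≤ Real.sqrt N) (hv : 0 < v)
    (σ : (ZMod N)ˣ) (a τ : ZMod N) (j : Fin k)
    (hsep : ∀ i ≠ j, v ≤ ((σ : ZMod N) * ω i + a).valMinAbs.natAbs)
    (hν : ∀ l < B, ‖ν (σ * (τ - (l : ZMod N)))‖ ≤ 1) (hsum : ‖noiseSum B ν σ a τ‖ ≤ B * r) :
    ‖(boxImpl N nPerm B K m b).filtered (signal ω α ν) σ a 0 τ -
      α j * dirichlet B ((σ : ZMod N) * ω j + a) * expVec ((σ : ZMod N) * ω j + a) τ‖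
        ≤ 12 * B * ((2 : ℝ) ^ b)⁻¹ + k * a₀ * (N / (2 * B * v)) / Real.sqrt N + r := by
  have hN : (0 : ℝ) < Real.sqrt N := Real.sqrt_pos.2 (Nat.cast_pos.2 (NeZero.pos N))
  have hB' : (0 : ℝ) < B := Nat.cast_pos.2 hB
  have ha0 : 0 ≤ a₀ := (norm_nonneg _).trans (hα j)
  have h1 := norm_filtered_sub_sum_le (nPerm := nPerm) (K := K) (m := m) hB hBN hb
    -- The tones and the noise contribute at most 1 each, so no sample saturates.
    (signal ω α ν) σ a τ fun l hl => by
      rw [signal]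
      refine (norm_add_le _ _).trans ?_
      have : ‖∑ i, α i * expVec (ω i) (σ * (τ - (l : ZMod N)))‖ ≤ 1 := by
        calc _ ≤ ∑ i : Fin k, a₀ * (1 / Real.sqrt N) := by
              refine norm_sum_le_of_le _ fun i _ => ?_
              rw [norm_mul, norm_expVec]
              gcongr
              exact hα i
          _ = k * a₀ / Real.sqrt N := by simp; ring
          _ ≤ 1 := by rwa [div_le_one hN]
      linarith [hν l hl]
  rw [sum_box_signal] at h1
  rw [← Finset.add_sum_erase _ _ (Finset.mem_univ j)] at h1
  have h2 : ‖∑ i ∈ Finset.univ.erase j, α i * dirichlet B ((σ : ZMod N) * ω i + a) * expVec ((σ : ZMod N) * ω i + a) τ‖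
      ≤ k * a₀ * (N / (2 * B * v)) / Real.sqrt N := by
    calc _ ≤ ∑ i ∈ Finset.univ.erase j, a₀ * (N / (2 * B * v)) * (1 / Real.sqrt N) := by
          refine norm_sum_le_of_le _ fun i hi => ?_
          rw [norm_mul, norm_mul, norm_expVec]
          gcongr
          · exact hα i
          · exact norm_dirichlet_le hB hv (hsep i (Finset.ne_of_mem_erase hi))
      _ ≤ ∑ i : Fin k, a₀ * (N / (2 * B * v)) * (1 / Real.sqrt N) :=
          Finset.sum_le_sum_of_subset_of_nonneg (Finset.erase_subset _ _)
            fun _ _ _ => by positivity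
      _ = _ := by simp; ring
  have h3 : ‖(B : ℂ)⁻¹ * noiseSum B ν σ a τ‖ ≤ r := by
    rw [norm_mul, norm_inv, Complex.norm_natCast, inv_mul_le_iff₀ hB']
    exact hsum
  set x := (boxImpl N nPerm B K m b).filtered (signal ω α ν) σ a 0 τ
  set y := α j * dirichlet B ((σ : ZMod N) * ω j + a) * expVec ((σ : ZMod N) * ω j + a) τ
  set z := ∑ i ∈ Finset.univ.erase j, α i * dirichlet B ((σ : ZMod N) * ω i + a) * expVec ((σ : ZMod N) * ω i + a) τ
  set w := (B : ℂ)⁻¹ * noiseSum B ν σ a τ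
  have e : x - y = (x - (y + z + w)) + z + w := by ring
  rw [e]
  refine (norm_add_le _ _).trans (add_le_add ((norm_add_le _ _).trans ?_) h3)
  exact add_le_add h1 h2

end BoxImpl

/-! ### Location and threshold test under a good permutation -/

section BoxImpl

variable {N : ℕ} [NeZero N] {nPerm B K m b : ℕ}

/-- With one sample point the estimate is √N times a demodulated sample, whose ideal value is γ at
every point. -/
lemma le_norm_coeff_boxImpl {X : ZMod N → ℂ} {γ : ℂ} {f : ZMod N} {e : ℝ}
    (t : Fin (boxImpl N nPerm B K m b).nThr → ZMod N) (t₀ : ZMod N) (ht : ∀ i, t i = t₀)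
    (hg : ‖γ‖ ≤ 1 / 2) (he : e ≤ 1) (hb : (16 : ℝ) ≤ 2 ^ b)
    (hX : ‖X t₀ - γ * ZMod.stdAddChar (f * t₀)‖ ≤ e) :
    Real.sqrt N * (‖γ‖ - e - 4 * ((2 : ℝ) ^ b)⁻¹) ≤ ‖(boxImpl N nPerm B K m b).coeff X f t‖ := by
  set η : ℝ := ((2 : ℝ) ^ b)⁻¹ with hη
  have hη0 : 0 < η := by positivity
  have he0 : 0 ≤ e := (norm_nonneg _).trans hX
  have hη1 : η ≤ 1 / 16 := by
    rw [hη, inv_le_comm₀ (by positivity) (by norm_num)]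
    linarith
  have hlist : List.ofFn t = [t₀] := by
    have h : ∀ t : Fin 1 → ZMod N, (∀ i, t i = t₀) → List.ofFn t = [t₀] := fun t ht => by simp [ht]
    exact h t ht
  have h1 : ‖rnd b (ZMod.stdAddChar (-(f * t₀))) - ZMod.stdAddChar (-(f * t₀))‖ ≤ η :=
    norm_rnd_sub_le (by rw [AddChar.norm_apply]; linarith)
  have hγ : ‖γ * ZMod.stdAddChar (f * t₀)‖ ≤ ‖γ‖ := by rw [norm_mul, AddChar.norm_apply, mul_one]
  have h2 := norm_rnd_mul_sub_le (b := b) hX h1 hγ (AddChar.norm_apply _ _).le (by nlinarith)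
  have h3 : γ * ZMod.stdAddChar (f * t₀) * ZMod.stdAddChar (-(f * t₀)) = γ := by
    rw [mul_assoc, ← AddChar.map_add_eq_mul, add_neg_cancel, AddChar.map_zero_eq_one, mul_one]
  rw [h3] at h2
  have h4 : ‖rnd b (0 + rnd b (X t₀ * rnd b (ZMod.stdAddChar (-(f * t₀))))) - γ‖ ≤ e + 4 * η := by
    rw [zero_add]
    have h2' : _ ≤ e + 3 * η := h2.trans (by nlinarith)
    exact (norm_rnd_sub_le' h2' hg (by linarith)).trans (by linarith)
  have h5 : (boxImpl N nPerm B K m b).coeff X f t =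
      ((Real.sqrt N : ℝ) : ℂ) * rnd b (0 + rnd b (X t₀ * rnd b (ZMod.stdAddChar (-(f * t₀))))) := by
    rw [SFFTImpl.coeff, hlist]
    simp [boxImpl]
  rw [h5, norm_mul, Complex.norm_real, Real.norm_of_nonneg (Real.sqrt_nonneg _)]
  gcongr
  have := norm_sub_norm_le γ (rnd b (0 + rnd b (X t₀ * rnd b (ZMod.stdAddChar (-(f * t₀))))))
  rw [norm_sub_rev] at this
  linarith

lemma mem_returned_of_location {μ : ℝ} {S : ZMod N → ℂ}
    {r : Fin nPerm → (boxImpl N nPerm B K m b).Draw} {w f : ZMod N} (p : Fin nPerm)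
    (hloc : (boxImpl N nPerm B K m b).location
      ((boxImpl N nPerm B K m b).filtered S (r p).1 (r p).2.1 0) (r p).2.2.1 = f)
    (hμ : μ ≤ ‖(boxImpl N nPerm B K m b).coeff
      ((boxImpl N nPerm B K m b).filtered S (r p).1 (r p).2.1 0) f (r p).2.2.2‖)
    (hw : w = (((r p).1⁻¹ : (ZMod N)ˣ) : ZMod N) * (f - (r p).2.1)) :
    w ∈ (boxImpl N nPerm B K m b).returned μ S r := by
  obtain ⟨j⟩ : Nonempty (Fin (boxImpl N nPerm B K m b).nInt) := ⟨(⟨0, Nat.one_pos⟩ : Fin 1)⟩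
  refine ⟨p, j, ?_⟩
  simp only [shift_boxImpl]
  rw [hloc]
  exact ⟨hμ, hw⟩

/-- The points at which `1SFFT` takes samples, when `t₀` is the sample point for the coefficient. -/
def samplePoints (N K m : ℕ) (t₀ : ZMod N) : List (ZMod N) :=
  t₀ :: 0 :: bisectTimes N (3 * m) (2 * K)

/-- The deterministic core: if (σ, a) isolates ω_j near 0 and the noise is small in the windows that
are read, then 1SFFT locates the tone and accepts it. All errors are measured in units of ρβ, where
β is the least modulus of a coefficient. -/
lemma location_and_coeff_boxImpl {k : ℕ} {ω : Fin k → ZMod N} {α : EuclideanSpace ℂ (Fin k)}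
    {ν : ZMod N → ℂ} {a₀ v β ρ κ : ℝ} (hB : 0 < B) (hBN : B ≤ N) (hb : 16 * (B : ℝ) ≤ 2 ^ b)
    (hK : 4 * K ≤ N) (hm : 2 * K < 2 ^ m) (hρ0 : 0 < ρ) (hρ : ρ ≤ 1 / 200) (hκ : κ ≤ 1 - 5 * ρ)
    (hβ : 0 < β) (hv : 0 < v) (hα : ∀ i, ‖α i‖ ≤ a₀) (ha₀ : (k + 4) * a₀ ≤ Real.sqrt N)
    (hgain : 2 * Real.pi * K * B / N ≤ ρ) (hleak : k * a₀ * (N / (2 * B * v)) ≤ ρ * β)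
    (hround : 12 * B * ((2 : ℝ) ^ b)⁻¹ * Real.sqrt N ≤ ρ * β)
    (hround' : 800 * ((2 : ℝ) ^ b)⁻¹ * N ≤ β ^ 2)
    (σ : (ZMod N)ˣ) (a : ZMod N) (u : Fin (boxImpl N nPerm B K m b).nSeed → ZMod N)
    (t : Fin (boxImpl N nPerm B K m b).nThr → ZMod N) (j : Fin k)
    (hαj : β ≤ ‖α j‖)
    (hf : ∃ δ ≤ 2 * K, (σ : ZMod N) * ω j + a = -(K : ZMod N) + (δ : ZMod N))
    (hsep : ∀ i ≠ j, v ≤ ((σ : ZMod N) * ω i + a).valMinAbs.natAbs)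
    (t₀ : ZMod N) (ht : ∀ i, t i = t₀)
    (hν : ∀ τ ∈ samplePoints N K m t₀, ∀ l < B, ‖ν (σ * (τ - (l : ZMod N)))‖ ≤ 1)
    (hsum : ∀ τ ∈ samplePoints N K m t₀,
      ‖noiseSum B ν σ a τ‖ ≤ B * (ρ * β / Real.sqrt N)) :
    (boxImpl N nPerm B K m b).location
      ((boxImpl N nPerm B K m b).filtered (signal ω α ν) σ a 0) u = σ * ω j + a ∧
    κ * β ≤ ‖(boxImpl N nPerm B K m b).coeff
      ((boxImpl N nPerm B K m b).filtered (signal ω α ν) σ a 0) (σ * ω j + a) t‖ := by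
  set f : ZMod N := (σ : ZMod N) * ω j + a with hfdef
  set η : ℝ := ((2 : ℝ) ^ b)⁻¹ with hη
  have hη0 : 0 < η := by positivity
  have hN : (0 : ℝ) < N := Nat.cast_pos.2 (NeZero.pos N)
  set q := Real.sqrt N with hq
  have hq0 : 0 < q := Real.sqrt_pos.2 hN
  have hqq : q ^ 2 = N := Real.sq_sqrt hN.le
  have hB1 : (1 : ℝ) ≤ B := by exact_mod_cast hB
  have hk1 : (1 : ℝ) ≤ k := by exact_mod_cast (show 1 ≤ k from Nat.one_le_iff_ne_zero.2 fun h => by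
    subst h; exact j.elim0)
  have ha0 : 0 ≤ a₀ := (norm_nonneg _).trans (hα j)
  have hβa : β ≤ a₀ := hαj.trans (hα j)
  set D := dirichlet B f
  have hD : ‖D - 1‖ ≤ ρ := by
    obtain ⟨δ, hδ, hfδ⟩ := hf
    have e : f = ((-(K : ℤ) + (δ : ℤ) : ℤ) : ZMod N) := by rw [hfδ]; push_cast; rfl
    simp only [D]
    rw [e]
    refine (norm_dirichlet_sub_one_le hB _).trans (le_trans ?_ hgain)
    have : |((-(K : ℤ) + (δ : ℤ) : ℤ) : ℝ)| ≤ K := by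
      have h : |(-(K : ℤ) + (δ : ℤ) : ℤ)| ≤ K := by rw [abs_le]; omega
      exact_mod_cast h
    gcongr
  have hD1 : 1 - ρ ≤ ‖D‖ := by
    have := norm_sub_norm_le (1 : ℂ) D
    rw [norm_one, norm_sub_rev] at this
    linarith
  have hD2 : ‖D‖ ≤ 1 + ρ := by
    have := norm_sub_norm_le D 1
    rw [norm_one] at this
    linarith
  set γ : ℂ := α j * D / (q : ℂ) with hγ
  have hγn : ‖γ‖ = ‖α j‖ * ‖D‖ / q := by
    rw [hγ, norm_div, norm_mul, Complex.norm_real, Real.norm_of_nonneg hq0.le]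
  have hγ1 : β * (1 - ρ) ≤ ‖γ‖ * q := by
    rw [hγn, div_mul_cancel₀ _ hq0.ne']
    have : (0 : ℝ) ≤ 1 - ρ := by linarith
    gcongr
  have hγ2 : ‖γ‖ ≤ 1 / 2 := by
    rw [hγn, div_le_iff₀ hq0]
    have : ‖α j‖ * ‖D‖ ≤ a₀ * (1 + ρ) := by
      gcongr
      exact hα j
    have h1 := mul_le_mul_of_nonneg_left hρ ha0
    have h2 := mul_nonneg (Nat.cast_nonneg (α := ℝ) k) ha0
    linarith
  have hγ0 : 0 < ‖γ‖ := by
    have : 0 < ‖γ‖ * q := lt_of_lt_of_le (mul_pos hβ (by linarith)) hγ1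
    exact pos_of_mul_pos_left this hq0.le
  -- One share each for rounding, leakage and noise.
  set e : ℝ := 3 * (ρ * β / q) with he
  have heq : e * q = 3 * (ρ * β) := by rw [he]; field_simp
  have hηq : 12 * (η * q) ≤ ρ * β := by
    refine le_trans ?_ hround
    have := mul_le_mul_of_nonneg_right hB1 (by positivity : 0 ≤ η * q)
    linarith
  have hρβ : ρ * β ≤ β / 200 := by
    have := mul_le_mul_of_nonneg_right hρ hβ.le
    linarith
  have happrox : ∀ τ ∈ samplePoints N K m t₀,
      ‖(boxImpl N nPerm B K m b).filtered (signal ω α ν) σ a 0 τ - γ * ZMod.stdAddChar (f * τ)‖ ≤ e := by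
    intro τ hτ
    have h := norm_filtered_signal_sub_le (nPerm := nPerm) (K := K) (m := m) hB hBN hb hα
      (by linarith) hv σ a τ j hsep (hν τ hτ) (hsum τ hτ)
    have e1 : α j * dirichlet B ((σ : ZMod N) * ω j + a) * expVec ((σ : ZMod N) * ω j + a) τ =
        γ * ZMod.stdAddChar (f * τ) := by
      rw [← hfdef, expVec, hγ]
      ring
    rw [e1] at h
    refine h.trans ?_
    have h1 : 12 * B * η ≤ ρ * β / q := by rwa [le_div_iff₀ hq0]
    have h2 : k * a₀ * (N / (2 * B * v)) / q ≤ ρ * β / q := by gcongr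
    linarith
  have hη' : 200 * η ≤ ‖γ‖ ^ 2 := by
    have h1 : (β * (1 - ρ)) ^ 2 ≤ (‖γ‖ * q) ^ 2 :=
      pow_le_pow_left₀ (mul_nonneg hβ.le (by linarith)) hγ1 2
    rw [mul_pow _ q, hqq] at h1
    have h2 : β ^ 2 / 4 ≤ (β * (1 - ρ)) ^ 2 := by
      rw [mul_pow]
      have : (1 : ℝ) / 4 ≤ (1 - ρ) ^ 2 := by
        calc (1 : ℝ) / 4 = (1 / 2) ^ 2 := by norm_num
          _ ≤ _ := by gcongr; linarith
      have := mul_le_mul_of_nonneg_left this (sq_nonneg β)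
      linarith
    have h3 : 200 * η * N ≤ ‖γ‖ ^ 2 * N := by linarith
    exact le_of_mul_le_mul_right h3 hN
  have he' : e + 2 * η ≤ ‖γ‖ / 32 := by
    have h3 : (e + 2 * η) * q ≤ ‖γ‖ / 32 * q := by linarith
    exact le_of_mul_le_mul_right h3 hq0
  have hX0 := happrox 0 (by simp [samplePoints])
  rw [mul_zero, AddChar.map_zero_eq_one, mul_one] at hX0
  refine ⟨runProgram_locateProgram _ hγ0 hγ2 hη' he' hK hm hX0
    (fun t ht => happrox t (by simp [samplePoints, ht])) hf, ?_⟩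
  have h16 : (16 : ℝ) ≤ 2 ^ b := by linarith
  have he1 : e ≤ 1 := by linarith
  refine le_trans ?_ (le_norm_coeff_boxImpl t t₀ ht hγ2 he1 h16
    (happrox t₀ (by simp [samplePoints])))
  -- The filter costs ρβ, the sample error 3ρβ and the rounding of the estimate less than ρβ, in
  -- total less than the margin 5ρβ.
  have := mul_le_mul_of_nonneg_right hκ hβ.le
  have := mul_pos hρ0 hβ
  rw [← hq, ← hη]
  linarith

end BoxImpl

/-! ### Tails of the noise -/

/-- Unimodular weights only rotate the directions, so each real component of the sum is sub-Gaussian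
with parameter |s|v; four directions control the modulus. -/
lemma IsSubgaussianNoise.measure_pi_norm_sum_ge_le {ι : Type*} [Fintype ι] {P : Measure ℂ} {v : ℝ}
    (hP : IsSubgaussianNoise P v) (hv : 0 ≤ v) (s : Finset ι) (c : ι → ℂ) (hc : ∀ i, ‖c i‖ = 1)
    {x : ℝ} (hx : 0 ≤ x) :
    (Measure.pi fun _ : ι => P) {ν | x < ‖∑ i ∈ s, c i * ν i‖} ≤
      ENNReal.ofReal (4 * Real.exp (-x ^ 2 / (8 * (s.card * v)))) := by
  have := hP.isProbabilityMeasure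
  set Q : Measure (ι → ℂ) := Measure.pi fun _ : ι => P
  have tail : ∀ w : ℂ, ‖w‖ = 1 → Q {ν | x / 2 ≤ (w * ∑ i ∈ s, c i * ν i).re} ≤
      ENNReal.ofReal (Real.exp (-x ^ 2 / (8 * (s.card * v)))) := by
    intro w hw
    have hone : ∀ i, HasSubgaussianMGF (fun ν : ι → ℂ => (w * c i * ν i).re) v.toNNReal Q := by
      intro i
      have h := hP.subgaussian (starRingEnd ℂ (w * c i)) (by
        rw [RCLike.norm_conj, norm_mul, hw, hc, one_mul])
      simp only [Complex.conj_conj] at h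
      have hmp := measurePreserving_eval (fun _ : ι => P) i
      rw [← hmp.map_eq] at h
      exact HasSubgaussianMGF.of_map (Y := Function.eval i) (X := fun z : ℂ => (w * c i * z).re)
        hmp.measurable.aemeasurable h
    have hind : iIndepFun (fun i (ν : ι → ℂ) => (w * c i * ν i).re) Q :=
      iIndepFun_pi (X := fun i z => (w * c i * z).re) fun i => by fun_prop
    have hsum := HasSubgaussianMGF.sum_of_iIndepFun hind (s := s) fun i _ => hone i
    have htail := hsum.measure_ge_le (ε := x / 2) (by positivity)
    have e1 : ∀ ν : ι → ℂ, (w * ∑ i ∈ s, c i * ν i).re = ∑ i ∈ s, (w * c i * ν i).re := by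
      intro ν
      rw [Finset.mul_sum, Complex.re_sum]
      exact Finset.sum_congr rfl fun i _ => by rw [mul_assoc]
    have e2 : -(x / 2) ^ 2 / (2 * ((∑ _i ∈ s, v.toNNReal : ℝ≥0) : ℝ)) =
        -x ^ 2 / (8 * (s.card * v)) := by
      simp only [Finset.sum_const, nsmul_eq_mul, NNReal.coe_mul, NNReal.coe_natCast,
        Real.coe_toNNReal _ hv]
      rw [show -(x / 2) ^ 2 = -x ^ 2 / 4 by ring, div_div]
      congr 1
      ring
    rw [e2] at htail
    simp only [e1]
    rw [← ofReal_measureReal]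
    exact ENNReal.ofReal_le_ofReal htail
  -- Since |z| ≤ |Re z| + |Im z|, one of ±Re z, ±Im z is at least x/2.
  have hsub : {ν : ι → ℂ | x < ‖∑ i ∈ s, c i * ν i‖} ⊆
      {ν | x / 2 ≤ (1 * ∑ i ∈ s, c i * ν i).re} ∪ {ν | x / 2 ≤ (-1 * ∑ i ∈ s, c i * ν i).re} ∪
      ({ν | x / 2 ≤ (Complex.I * ∑ i ∈ s, c i * ν i).re} ∪
        {ν | x / 2 ≤ (-Complex.I * ∑ i ∈ s, c i * ν i).re}) := by
    intro ν hν
    simp only [Set.mem_ofPred_eq, Set.mem_union] at hν ⊢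
    set z := ∑ i ∈ s, c i * ν i
    have hz := Complex.norm_le_abs_re_add_abs_im z
    simp only [one_mul, neg_mul, Complex.neg_re, Complex.mul_re, Complex.I_re, Complex.I_im,
      zero_mul, zero_sub, neg_neg]
    by_contra! hcon
    obtain ⟨⟨h1, h2⟩, h3, h4⟩ := hcon
    have := abs_lt.2 ⟨by linarith, h1⟩
    have := abs_lt.2 ⟨by linarith, h4⟩
    linarith
  refine (measure_mono hsub).trans ((measure_union_le _ _).trans ((add_le_add
    (measure_union_le _ _) (measure_union_le _ _)).trans ((add_le_add (add_le_add
    (tail 1 (by simp)) (tail (-1) (by simp))) (add_le_add (tail Complex.I (by simp))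
    (tail (-Complex.I) (by simp)))).trans (le_of_eq ?_))))
  rw [← ENNReal.ofReal_add (by positivity) (by positivity),
    ← ENNReal.ofReal_add (by positivity) (by positivity)]
  congr 1
  ring

/-! ### Noise in the windows of the filter -/

section Window

variable {N : ℕ} [NeZero N] {B : ℕ} {P : Measure ℂ} {v : ℝ}

lemma measure_noiseSum_gt_le (hP : IsSubgaussianNoise P v) (hv : 0 ≤ v) (hBN : B ≤ N)
    (σ : (ZMod N)ˣ) (a τ : ZMod N) {x : ℝ} (hx : 0 ≤ x) :
    (Measure.pi fun _ : ZMod N => P) {ν | x < ‖noiseSum B ν σ a τ‖} ≤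
      ENNReal.ofReal (4 * Real.exp (-x ^ 2 / (8 * (B * v)))) := by
  classical
  -- For B ≤ N and a unit σ the window meets B distinct, hence independent, noise variables.
  have hinj : Set.InjOn (fun l : ℕ => (σ : ZMod N) * (τ - (l : ZMod N))) (Finset.range B) := by
    intro l hl l' hl' h
    have hl := (Finset.mem_range.1 hl).trans_le hBN
    have hl' := (Finset.mem_range.1 hl').trans_le hBN
    have h1 : (l : ZMod N) = (l' : ZMod N) := sub_right_injective (σ.isUnit.mul_right_injective h)
    have h2 := congrArg ZMod.val h1
    rwa [ZMod.val_cast_of_lt hl, ZMod.val_cast_of_lt hl'] at h2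
  have e : ∀ ν : ZMod N → ℂ, noiseSum B ν σ a τ =
      ∑ x ∈ (Finset.range B).image fun l : ℕ => (σ : ZMod N) * (τ - (l : ZMod N)),
        ZMod.stdAddChar (a * (((σ⁻¹ : (ZMod N)ˣ) : ZMod N) * x)) * ν x := by
    intro ν
    rw [Finset.sum_image hinj, noiseSum]
    refine Finset.sum_congr rfl fun l _ => ?_
    rw [← mul_assoc ((σ⁻¹ : (ZMod N)ˣ) : ZMod N), Units.inv_mul, one_mul]
  simp only [e]
  refine (hP.measure_pi_norm_sum_ge_le hv _ _ (fun _ => AddChar.norm_apply _ _) hx).trans ?_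
  rw [Finset.card_image_of_injOn hinj, Finset.card_range]

lemma measure_norm_gt_le (hP : IsSubgaussianNoise P v) (hv : 0 ≤ v) (y : ZMod N) :
    (Measure.pi fun _ : ZMod N => P) {ν | 1 < ‖ν y‖} ≤
      ENNReal.ofReal (4 * Real.exp (-1 / (8 * v))) := by
  have h := hP.measure_pi_norm_sum_ge_le hv {y} (fun _ => 1) (fun _ => norm_one) zero_le_one
  simpa using h

lemma measure_noise_large_le (hP : IsSubgaussianNoise P v) (hv : 0 ≤ v) (hBN : B ≤ N)
    (σ : (ZMod N)ˣ) (a : ZMod N) (T : List (ZMod N)) {x : ℝ} (hx : 0 ≤ x) :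
    (Measure.pi fun _ : ZMod N => P)
      {ν | ∀ τ ∈ T, (∀ l < B, ‖ν (σ * (τ - (l : ZMod N)))‖ ≤ 1) ∧ ‖noiseSum B ν σ a τ‖ ≤ x}ᶜ ≤
      ENNReal.ofReal (T.length * (4 * (B * Real.exp (-1 / (8 * v)) +
        Real.exp (-x ^ 2 / (8 * (B * v)))))) := by
  induction T with
  | nil => simp
  | cons τ T ih =>
    have hsub : {ν : ZMod N → ℂ | ∀ τ' ∈ τ :: T,
        (∀ l < B, ‖ν (σ * (τ' - (l : ZMod N)))‖ ≤ 1) ∧ ‖noiseSum B ν σ a τ'‖ ≤ x}ᶜ ⊆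
        ((⋃ l ∈ Finset.range B, {ν | 1 < ‖ν (σ * (τ - (l : ZMod N)))‖}) ∪
          {ν | x < ‖noiseSum B ν σ a τ‖}) ∪
        {ν | ∀ τ' ∈ T, (∀ l < B, ‖ν (σ * (τ' - (l : ZMod N)))‖ ≤ 1) ∧
          ‖noiseSum B ν σ a τ'‖ ≤ x}ᶜ := by
      intro ν hν
      by_contra hcon
      simp only [Set.mem_union, Set.mem_iUnion, Set.mem_ofPred_eq, not_or, not_exists, not_lt,
        Finset.mem_range, Set.mem_compl_iff, not_not] at hcon
      apply hν
      intro τ' hτ'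
      rcases List.mem_cons.1 hτ' with rfl | h
      · exact ⟨fun l hl => hcon.1.1 l hl, hcon.1.2⟩
      · exact hcon.2 τ' h
    have h1 : (Measure.pi fun _ : ZMod N => P)
        (⋃ l ∈ Finset.range B, {ν | 1 < ‖ν (σ * (τ - (l : ZMod N)))‖}) ≤
        ENNReal.ofReal (B * (4 * Real.exp (-1 / (8 * v)))) := by
      refine (measure_biUnion_finset_le _ _).trans ((Finset.sum_le_sum fun l _ =>
        measure_norm_gt_le hP hv _).trans (le_of_eq ?_))
      rw [Finset.sum_const, Finset.card_range, nsmul_eq_mul, ENNReal.ofReal_mul (Nat.cast_nonneg _),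
        ENNReal.ofReal_natCast]
    refine (measure_mono hsub).trans ((measure_union_le _ _).trans ((add_le_add
      ((measure_union_le _ _).trans (add_le_add h1 (measure_noiseSum_gt_le hP hv hBN σ a τ hx)))
      ih).trans (le_of_eq ?_)))
    rw [← ENNReal.ofReal_add (by positivity) (by positivity),
      ← ENNReal.ofReal_add (by positivity) (by positivity)]
    congr 1
    simp only [List.length_cons]
    push_cast
    ring

lemma measurableSet_noise_small (σ : (ZMod N)ˣ) (a : ZMod N) (T : List (ZMod N)) (x : ℝ) :
    MeasurableSet {ν : ZMod N → ℂ | ∀ τ ∈ T,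
      (∀ l < B, ‖ν (σ * (τ - (l : ZMod N)))‖ ≤ 1) ∧ ‖noiseSum B ν σ a τ‖ ≤ x} := by
  have : {ν : ZMod N → ℂ | ∀ τ ∈ T,
      (∀ l < B, ‖ν (σ * (τ - (l : ZMod N)))‖ ≤ 1) ∧ ‖noiseSum B ν σ a τ‖ ≤ x} =
      ⋂ τ ∈ {τ | τ ∈ T}, ((⋂ l ∈ {l | l < B}, {ν | ‖ν (σ * (τ - (l : ZMod N)))‖ ≤ 1}) ∩
        {ν | ‖noiseSum B ν σ a τ‖ ≤ x}) := by
    ext ν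
    simp
  rw [this]
  refine MeasurableSet.biInter (Set.to_countable _) fun τ _ => MeasurableSet.inter
    (MeasurableSet.biInter (Set.to_countable _) fun l _ => ?_) ?_
  · exact measurableSet_le (by fun_prop) measurable_const
  · unfold noiseSum
    exact measurableSet_le (by fun_prop) measurable_const

end Window

/-! ### The law of the coefficients -/

section Coeff

variable {k : ℕ} {A ε : ℝ}

lemma measurableSet_coeffSet : MeasurableSet (coeffSet k A ε) := by
  have : coeffSet k A ε = {x | ‖x‖ ^ 2 = A} ∩
      ⋂ j, ({x | x j = 0} ∪ {x | ε * Real.sqrt (A / k) ≤ ‖x j‖}) := by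
    ext x
    simp only [coeffSet, Set.mem_ofPred_eq, Set.mem_inter_iff, Set.mem_iInter, Set.mem_union]
    refine and_congr_right fun _ => forall_congr' fun j => ?_
    tauto
  rw [this]
  refine MeasurableSet.inter (measurableSet_eq_fun (by fun_prop) measurable_const)
    (MeasurableSet.iInter fun j => MeasurableSet.union
      (measurableSet_eq_fun (by fun_prop) measurable_const)
      (measurableSet_le measurable_const (by fun_prop)))

lemma measurable_sphere_smul : Measurable fun u : Metric.sphere (0 : EuclideanSpace ℂ (Fin k)) 1 =>
    Real.sqrt A • (u : EuclideanSpace ℂ (Fin k)) :=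
  measurable_subtype_coe.const_smul (Real.sqrt A)

instance : IsFiniteMeasure (sphereMeasure k A) := by
  unfold sphereMeasure
  infer_instance

/-- The cone over this set lies in a proper real subspace, which is a null set. -/
lemma sphereMeasure_coord_eq_zero (hA : 0 < A) (j : Fin k) :
    sphereMeasure k A {x | x j = 0} = 0 := by
  have hms : MeasurableSet {x : EuclideanSpace ℂ (Fin k) | x j = 0} :=
    measurableSet_eq_fun (by fun_prop) measurable_const
  rw [sphereMeasure, Measure.map_apply measurable_sphere_smul hms,
    Measure.toSphere_apply' _ (measurable_sphere_smul hms)]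
  let L : EuclideanSpace ℂ (Fin k) →ₗ[ℝ] ℂ :=
    ((EuclideanSpace.proj j : EuclideanSpace ℂ (Fin k) →L[ℂ] ℂ) :
      EuclideanSpace ℂ (Fin k) →ₗ[ℂ] ℂ).restrictScalars ℝ
  have hL : ∀ x, L x = x j := fun x => rfl
  have hker : LinearMap.ker L ≠ ⊤ := by
    intro h
    have : EuclideanSpace.single j (1 : ℂ) ∈ LinearMap.ker L := h ▸ Submodule.mem_top
    rw [LinearMap.mem_ker, hL] at this
    simp at this
  have h0 := Measure.addHaar_submodule (volume : Measure (EuclideanSpace ℂ (Fin k))) _ hker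
  refine mul_eq_zero_of_right _ (measure_mono_null ?_ h0)
  rintro _ ⟨c, _, _, ⟨u, hu, rfl⟩, rfl⟩
  have hu' : Real.sqrt A • (u : EuclideanSpace ℂ (Fin k)) j = 0 := hu
  have hu0 : (u : EuclideanSpace ℂ (Fin k)) j = 0 := by
    rcases smul_eq_zero.1 hu' with h | h
    · exact absurd h (Real.sqrt_pos.2 hA).ne'
    · exact h
  change c • (u : EuclideanSpace ℂ (Fin k)) ∈ LinearMap.ker L
  rw [LinearMap.mem_ker, map_smul, hL, hu0, smul_zero]

/-- The cone over the set contains a nonempty open set around a vector with equal coordinates, as ε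
< 1. This makes the conditional law a probability measure. -/
lemma sphereMeasure_coeffSet_ne_zero (hk : 1 ≤ k) (hA : 0 < A) (hε : ε < 1) :
    sphereMeasure k A (coeffSet k A ε) ≠ 0 := by
  have hk0 : (0 : ℝ) < k := by exact_mod_cast hk
  have : Nonempty (Fin k) := ⟨⟨0, hk⟩⟩
  have hms := measurableSet_coeffSet (k := k) (A := A) (ε := ε)
  rw [sphereMeasure, Measure.map_apply measurable_sphere_smul hms,
    Measure.toSphere_apply' _ (measurable_sphere_smul hms)]
  refine mul_ne_zero (Nat.cast_ne_zero.2 Module.finrank_pos.ne') ?_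
  set V : Set (EuclideanSpace ℂ (Fin k)) :=
    {x | 0 < ‖x‖} ∩ ({x | ‖x‖ < 1} ∩ ⋂ j, {x | ε / Real.sqrt k * ‖x‖ < ‖x j‖})
  have hVo : IsOpen V := by
    refine IsOpen.inter (isOpen_lt continuous_const continuous_norm) (IsOpen.inter
      (isOpen_lt continuous_norm continuous_const) (isOpen_iInter_of_finite fun j =>
        isOpen_lt (by fun_prop) (by fun_prop)))
  have hsk : 0 < Real.sqrt k := Real.sqrt_pos.2 hk0
  have hVn : V.Nonempty := by
    set x : EuclideanSpace ℂ (Fin k) :=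
      WithLp.toLp 2 fun _ => ((1 / (2 * Real.sqrt k) : ℝ) : ℂ) with hx
    have hxj : ∀ j, ‖x j‖ = 1 / (2 * Real.sqrt k) := by
      intro j
      change ‖((1 / (2 * Real.sqrt k) : ℝ) : ℂ)‖ = _
      rw [Complex.norm_real, Real.norm_of_nonneg (by positivity)]
    have hxn : ‖x‖ = 1 / 2 := by
      rw [EuclideanSpace.norm_eq]
      simp only [hxj, Finset.sum_const, Finset.card_univ, Fintype.card_fin, nsmul_eq_mul]
      rw [div_pow, mul_pow, Real.sq_sqrt hk0.le, show (k : ℝ) * (1 ^ 2 / (2 ^ 2 * k)) = (1 / 2) ^ 2 by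
        field_simp, Real.sqrt_sq (by norm_num)]
    refine ⟨x, by simp only [Set.mem_ofPred_eq, hxn]; norm_num, by simp only [Set.mem_ofPred_eq, hxn]; norm_num, ?_⟩
    simp only [Set.mem_iInter, Set.mem_ofPred_eq, hxj, hxn]
    intro _
    rw [div_mul_eq_mul_div, div_lt_div_iff₀ hsk (by positivity)]
    nlinarith
  refine fun h => (hVo.measure_pos volume hVn).ne' (measure_mono_null ?_ h)
  rintro x ⟨h0, h1, h2⟩
  simp only [Set.mem_ofPred_eq, Set.mem_iInter] at h0 h1 h2
  refine ⟨‖x‖, ⟨h0, h1⟩, ‖x‖⁻¹ • x, ⟨⟨‖x‖⁻¹ • x, ?_⟩, ?_, rfl⟩, ?_⟩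
  · rw [mem_sphere_zero_iff_norm, norm_smul, norm_inv, norm_norm, inv_mul_cancel₀ h0.ne']
  · change Real.sqrt A • (‖x‖⁻¹ • x) ∈ coeffSet k A ε
    have hsA : 0 < Real.sqrt A := Real.sqrt_pos.2 hA
    refine ⟨?_, fun j _ => ?_⟩
    · rw [norm_smul, norm_smul, norm_inv, norm_norm, inv_mul_cancel₀ h0.ne', mul_one,
        Real.norm_of_nonneg hsA.le, Real.sq_sqrt hA.le]
    · change _ ≤ ‖Real.sqrt A • (‖x‖⁻¹ • x j)‖
      rw [norm_smul, norm_smul, norm_inv, norm_norm, Real.norm_of_nonneg hsA.le,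
        Real.sqrt_div hA.le, inv_mul_eq_div]
      calc ε * (Real.sqrt A / Real.sqrt k) = Real.sqrt A * (ε / Real.sqrt k) := by ring
        _ ≤ _ := by
          refine mul_le_mul_of_nonneg_left ?_ hsA.le
          rw [le_div_iff₀ h0]
          exact (h2 j).le
  · change ‖x‖ • ‖x‖⁻¹ • x = x
    rw [smul_inv_smul₀ h0.ne']

lemma isProbabilityMeasure_coeffLaw (hk : 1 ≤ k) (hA : 0 < A) (hε : ε < 1) :
    IsProbabilityMeasure (coeffLaw k A ε) :=
  cond_isProbabilityMeasure (sphereMeasure_coeffSet_ne_zero hk hA hε)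

/-- The coefficient vectors in `B_ε` without a zero entry. -/
def fullCoeffSet (k : ℕ) (A ε : ℝ) : Set (EuclideanSpace ℂ (Fin k)) :=
  {x | ‖x‖ ^ 2 = A ∧ ∀ j, ε * Real.sqrt (A / k) ≤ ‖x j‖}

lemma measurableSet_fullCoeffSet : MeasurableSet (fullCoeffSet k A ε) := by
  have : fullCoeffSet k A ε = {x | ‖x‖ ^ 2 = A} ∩
      ⋂ j, {x | ε * Real.sqrt (A / k) ≤ ‖x j‖} := by
    ext x
    simp [fullCoeffSet]
  rw [this]
  exact MeasurableSet.inter (measurableSet_eq_fun (by fun_prop) measurable_const)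
    (MeasurableSet.iInter fun j => measurableSet_le measurable_const (by fun_prop))

/-- `coeffSet` admits vanishing coordinates, but these occur with probability zero, so every
coefficient is almost surely above the threshold scale. -/
lemma coeffLaw_fullCoeffSet (hk : 1 ≤ k) (hA : 0 < A) (hε : ε < 1) :
    coeffLaw k A ε (fullCoeffSet k A ε) = 1 := by
  have := isProbabilityMeasure_coeffLaw hk hA hε
  rw [prob_compl_eq_zero_iff measurableSet_fullCoeffSet |>.symm, coeffLaw,
    cond_apply measurableSet_coeffSet]
  refine mul_eq_zero_of_right _ (measure_mono_null (t := ⋃ j : Fin k, {x | x j = 0}) ?_ ?_)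
  · rintro x ⟨⟨hx, hx'⟩, hxc⟩
    by_contra hcon
    simp only [Set.mem_iUnion, Set.mem_ofPred_eq, not_exists] at hcon
    exact hxc ⟨hx, fun j => hx' j (hcon j)⟩
  · exact measure_iUnion_null fun j => sphereMeasure_coord_eq_zero hA j

end Coeff

/-! ### The probability of detection -/

/-- If a fraction θ of the draws is good, n independent draws all miss with probability at most (1 -
θ)^n ≤ exp(-nθ). Here `M r` stands for the probability over signal and noise for fixed draws r. -/
lemma ofReal_le_sum_div_card {D : Type*} [Fintype D] [Nonempty D] {n : ℕ} (G : Finset D)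
    (M : (Fin n → D) → ℝ≥0∞) {c θ : ℝ} (hc : 0 ≤ c) (hθ : θ * Fintype.card D ≤ G.card)
    (hM : ∀ r, (∃ p, r p ∈ G) → ENNReal.ofReal c ≤ M r) :
    ENNReal.ofReal (c * (1 - Real.exp (-(n * θ)))) ≤
      (∑ r, M r) / (Fintype.card (Fin n → D) : ℝ≥0∞) := by
  classical
  have hD : (0 : ℝ) < Fintype.card D := by exact_mod_cast Fintype.card_pos
  set d : ℝ := (Fintype.card D : ℝ) with hd
  have hGd : (G.card : ℝ) ≤ d := by rw [hd]; exact_mod_cast Finset.card_le_univ G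
  set bad : Finset (Fin n → D) := Fintype.piFinset fun _ => Gᶜ
  have hbad : (bad.card : ℝ) = (d - G.card) ^ n := by
    rw [Fintype.card_piFinset, Finset.prod_const, Finset.card_univ, Fintype.card_fin,
      Finset.card_compl, Nat.cast_pow, Nat.cast_sub (Finset.card_le_univ G)]
  have hcard : (Fintype.card (Fin n → D) : ℝ) = d ^ n := by simp [hd]
  have hbad' : (bad.card : ℝ) ≤ d ^ n * Real.exp (-(n * θ)) := by
    have h1 : d - G.card ≤ d * Real.exp (-θ) := by
      have := Real.add_one_le_exp (-θ)
      nlinarith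
    calc (bad.card : ℝ) = (d - G.card) ^ n := hbad
      _ ≤ (d * Real.exp (-θ)) ^ n := pow_le_pow_left₀ (by linarith) h1 n
      _ = _ := by rw [mul_pow, ← Real.exp_nat_mul]; ring_nf
  have hgood : d ^ n * (1 - Real.exp (-(n * θ))) ≤ (badᶜ.card : ℝ) := by
    rw [Finset.card_compl, Nat.cast_sub (Finset.card_le_univ bad), hcard]
    linarith
  have hsum : (badᶜ.card : ℝ≥0∞) * ENNReal.ofReal c ≤ ∑ r, M r := by
    calc (badᶜ.card : ℝ≥0∞) * ENNReal.ofReal c = ∑ _r ∈ badᶜ, ENNReal.ofReal c := by simp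
      _ ≤ ∑ r ∈ badᶜ, M r := by
        refine Finset.sum_le_sum fun r hr => hM r ?_
        rw [Finset.mem_compl, Fintype.mem_piFinset] at hr
        push Not at hr
        obtain ⟨p, hp⟩ := hr
        exact ⟨p, by simpa using hp⟩
      _ ≤ ∑ r, M r := Finset.sum_le_sum_of_subset (Finset.subset_univ _)
  rw [ENNReal.le_div_iff_mul_le (Or.inl (by simp)) (Or.inl (ENNReal.natCast_ne_top _))]
  refine le_trans ?_ hsum
  rw [← ENNReal.ofReal_natCast, ← ENNReal.ofReal_natCast, ← ENNReal.ofReal_mul' (by positivity),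
    ← ENNReal.ofReal_mul (by positivity), hcard]
  refine ENNReal.ofReal_le_ofReal ?_
  calc _ = (d ^ n * (1 - Real.exp (-(n * θ)))) * c := by ring
    _ ≤ _ := by gcongr

/-! ### Counting good spectral permutations -/

section Pairs

variable {N : ℕ} [NeZero N] {k : ℕ}

open Classical in
/-- The spectral permutations that move `ω j` into `[-K, K]` and all other frequencies away from
it by at least `y`. -/
def goodPairs (ω : Fin k → ZMod N) (j : Fin k) (K y : ℕ) : Finset ((ZMod N)ˣ × ZMod N) :=
  Finset.univ.filter fun q =>
    (∀ i ≠ j, y ≤ ((q.1 : ZMod N) * (ω i - ω j)).valMinAbs.natAbs) ∧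
      ∃ δ ≤ 2 * K, (q.1 : ZMod N) * ω j + q.2 = -(K : ZMod N) + (δ : ZMod N)

/-- At most 2ky ≤ φ(N)/2 units bring another frequency within y of the j-th, and each remaining unit
admits 2K + 1 shifts a. -/
lemma le_card_goodPairs {ω : Fin k → ZMod N} (hω : Function.Injective ω) (j : Fin k) {K y : ℕ}
    (hK : 4 * K ≤ N) (hy : 4 * k * y ≤ N.totient) :
    N.totient * K ≤ (goodPairs ω j K y).card := by
  classical
  set bad : Finset (ZMod N)ˣ := Finset.univ.biUnion fun i : Fin k =>
    if i = j then ∅ else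
      Finset.univ.filter fun σ : (ZMod N)ˣ => ((σ : ZMod N) * (ω i - ω j)).valMinAbs.natAbs < y
  have hbad : bad.card ≤ k * (2 * y) := by
    refine Finset.card_biUnion_le.trans ((Finset.sum_le_card_nsmul _ _ (2 * y) fun i _ => ?_).trans
      (by simp))
    split_ifs with h
    · simp
    · exact card_units_small_mul_le (sub_ne_zero.2 fun h' => h (hω h')) y
  have hgood : N.totient ≤ 2 * badᶜ.card := by
    rw [Finset.card_compl, ZMod.card_units_eq_totient]
    have : 4 * k * y = 2 * (k * (2 * y)) := by ring
    omega
  have hinj : badᶜ.card * (2 * K + 1) ≤ (goodPairs ω j K y).card := by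
    rw [← Finset.card_range (2 * K + 1), ← Finset.card_product]
    refine Finset.card_le_card_of_injOn
      (fun q => (q.1, -(K : ZMod N) + (q.2 : ZMod N) - (q.1 : ZMod N) * ω j)) ?_ ?_
    · rintro ⟨σ, δ⟩ h
      simp only [Finset.coe_product, Set.mem_prod, Finset.mem_coe, Finset.mem_compl,
        Finset.mem_range] at h
      simp only [goodPairs, Finset.coe_filter, Finset.mem_univ, true_and, Set.mem_ofPred_eq]
      refine ⟨fun i hi => ?_, δ, by omega, by ring⟩
      by_contra hcon
      refine h.1 (Finset.mem_biUnion.2 ⟨i, Finset.mem_univ _, ?_⟩)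
      rw [if_neg hi]
      simpa using hcon
    · rintro ⟨σ, δ⟩ h ⟨σ', δ'⟩ h' heq
      simp only [Finset.coe_product, Set.mem_prod, Finset.mem_coe, Finset.mem_range] at h h'
      simp only [Prod.mk.injEq] at heq ⊢
      obtain ⟨rfl, h2⟩ := heq
      refine ⟨rfl, ?_⟩
      have h3 : (δ : ZMod N) = (δ' : ZMod N) := add_left_cancel (sub_left_injective h2)
      have hN := NeZero.pos N
      have h4 := congrArg ZMod.val h3
      rwa [ZMod.val_cast_of_lt (by omega), ZMod.val_cast_of_lt (by omega)] at h4
  calc N.totient * K ≤ (2 * badᶜ.card) * K := Nat.mul_le_mul_right _ hgood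
    _ = badᶜ.card * (2 * K) := by ring
    _ ≤ badᶜ.card * (2 * K + 1) := Nat.mul_le_mul_left _ (by omega)
    _ ≤ _ := hinj

/-- Differences of frequencies do not depend on a; the triangle inequality loses at most K ≤ y/2. -/
lemma le_natAbs_valMinAbs_of_mem_goodPairs {ω : Fin k → ZMod N} {j : Fin k} {K y : ℕ}
    (hK : 4 * K ≤ N) (hKy : 2 * K ≤ y) {q : (ZMod N)ˣ × ZMod N} (hq : q ∈ goodPairs ω j K y)
    {i : Fin k} (hi : i ≠ j) :
    (y : ℝ) / 2 ≤ ((q.1 : ZMod N) * ω i + q.2).valMinAbs.natAbs := by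
  simp only [goodPairs, Finset.mem_filter, Finset.mem_univ, true_and] at hq
  obtain ⟨h1, δ, hδ, h2⟩ := hq
  have h3 := h1 i hi
  have hN := NeZero.pos N
  have h4 : ((q.1 : ZMod N) * ω j + q.2).valMinAbs = -(K : ℤ) + δ := by
    rw [ZMod.valMinAbs_spec, h2]
    refine ⟨by push_cast; rfl, ?_⟩
    rw [Set.mem_Ioc]
    omega
  have h5 := ZMod.natAbs_valMinAbs_add_le ((q.1 : ZMod N) * ω i + q.2)
    (-((q.1 : ZMod N) * ω j + q.2))
  have h6 : (q.1 : ZMod N) * ω i + q.2 + -((q.1 : ZMod N) * ω j + q.2) =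
      (q.1 : ZMod N) * (ω i - ω j) := by ring
  have h7 := Int.natAbs_add_le ((q.1 : ZMod N) * ω i + q.2).valMinAbs
    (-((q.1 : ZMod N) * ω j + q.2)).valMinAbs
  rw [ZMod.natAbs_valMinAbs_neg, h4] at h7
  rw [h6] at h5
  have h8 : y ≤ 2 * ((q.1 : ZMod N) * ω i + q.2).valMinAbs.natAbs := by omega
  rw [div_le_iff₀ two_pos]
  exact_mod_cast (by omega : y ≤ ((q.1 : ZMod N) * ω i + q.2).valMinAbs.natAbs * 2)

end Pairs

/-- Once some draw is good, success depends only on the noise in its windows, an event of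
probability at least 1 - δ. The second factor bounds the probability of a good draw. -/
lemma le_detectionProb_boxImpl {N : ℕ} [NeZero N] {nPerm B K m b k y : ℕ} {A ε s ρ κ δ : ℝ}
    (hk : 1 ≤ k) (hA : 0 < A) (hε₀ : 0 < ε) (hε : ε < 1) (hs : 0 < s)
    (hB : 0 < B) (hBN : B ≤ N) (hb : 16 * (B : ℝ) ≤ 2 ^ b)
    (hK : 4 * K ≤ N) (hm : 2 * K < 2 ^ m) (hρ0 : 0 < ρ) (hρ : ρ ≤ 1 / 200) (hκ : κ ≤ 1 - 5 * ρ)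
    (hy0 : 0 < y) (hKy : 2 * K ≤ y) (hy : 4 * k * y ≤ N.totient)
    (ha₀ : (k + 4) * Real.sqrt A ≤ Real.sqrt N) (hgain : 2 * Real.pi * K * B / N ≤ ρ)
    (hleak : k * Real.sqrt A * (N / (2 * B * ((y : ℝ) / 2))) ≤ ρ * (ε * Real.sqrt (A / k)))
    (hround : 12 * B * ((2 : ℝ) ^ b)⁻¹ * Real.sqrt N ≤ ρ * (ε * Real.sqrt (A / k)))
    (hround' : 800 * ((2 : ℝ) ^ b)⁻¹ * N ≤ (ε * Real.sqrt (A / k)) ^ 2)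
    (hδ1 : δ ≤ 1)
    (hδ : (3 * m + 2) * (4 * (B * Real.exp (-1 / (8 * (s ^ 2 / N))) +
      Real.exp (-(B * (ρ * (ε * Real.sqrt (A / k)) / Real.sqrt N)) ^ 2 /
        (8 * (B * (s ^ 2 / N)))))) ≤ δ)
    {P : Measure ℂ} (hP : IsSubgaussianNoise P (s ^ 2 / N)) {ω : Fin k → ZMod N}
    (hω : Function.Injective ω) (j : Fin k) :
    ENNReal.ofReal ((1 - δ) * (1 - Real.exp (-(nPerm * ((K : ℝ) / N))))) ≤
      (boxImpl N nPerm B K m b).detectionProb (κ * (ε * Real.sqrt (A / k))) A ε P ω j := by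
  classical
  set β := ε * Real.sqrt (A / k) with hβdef
  have hN : (0 : ℝ) < N := Nat.cast_pos.2 (NeZero.pos N)
  have hβ : 0 < β := mul_pos hε₀ (Real.sqrt_pos.2 (div_pos hA (by exact_mod_cast hk)))
  set I := boxImpl N nPerm B K m b
  -- Goodness concerns only the pair (σ, a); the sample point for the coefficient is arbitrary.
  set G : Finset I.Draw := (goodPairs ω j K y ×ˢ
    (Finset.univ : Finset ((Fin I.nSeed → ZMod N) × (Fin I.nThr → ZMod N)))).map
    (Equiv.prodAssoc (ZMod N)ˣ (ZMod N)
      ((Fin I.nSeed → ZMod N) × (Fin I.nThr → ZMod N))).toEmbedding with hG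
  refine ofReal_le_sum_div_card (D := I.Draw) G _ (by linarith) ?_ ?_
  · have h1 : (N.totient * K : ℝ) ≤ (goodPairs ω j K y).card := by
      exact_mod_cast le_card_goodPairs hω j hK hy
    rw [hG, Finset.card_map, Finset.card_product, Finset.card_univ]
    change (K : ℝ) / N * (Fintype.card ((ZMod N)ˣ × ZMod N ×
      ((Fin I.nSeed → ZMod N) × (Fin I.nThr → ZMod N))) : ℝ) ≤ _
    rw [Fintype.card_prod, Fintype.card_prod, ZMod.card, ZMod.card_units_eq_totient]
    push_cast
    calc _ = (N.totient * K : ℝ) *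
          (Fintype.card ((Fin I.nSeed → ZMod N) × (Fin I.nThr → ZMod N)) : ℝ) := by field_simp
      _ ≤ _ := by gcongr
  · rintro r ⟨p, hp⟩
    obtain ⟨⟨q, z⟩, hq, hqr⟩ := Finset.mem_map.1 hp
    have hq : q ∈ goodPairs ω j K y := (Finset.mem_product.1 hq).1
    have hσ : (r p).1 = q.1 := by rw [← hqr]; rfl
    have ha : (r p).2.1 = q.2 := by rw [← hqr]; rfl
    obtain ⟨t₀, ht⟩ : ∃ t₀, ∀ i, (r p).2.2.2 i = t₀ := by
      refine ⟨(r p).2.2.2 (⟨0, Nat.one_pos⟩ : Fin 1), fun i => ?_⟩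
      exact congrArg _ (Subsingleton.elim (α := Fin 1) _ _)
    have hprobP := hP.isProbabilityMeasure
    have hprobC := isProbabilityMeasure_coeffLaw hk hA hε
    have hv : 0 ≤ s ^ 2 / (N : ℝ) := by positivity
    set x : ℝ := B * (ρ * β / Real.sqrt N) with hx
    have hx0 : 0 ≤ x := by positivity
    set W : Set (ZMod N → ℂ) := {ν | ∀ τ ∈ samplePoints N K m t₀,
      (∀ l < B, ‖ν (q.1 * (τ - (l : ZMod N)))‖ ≤ 1) ∧ ‖noiseSum B ν q.1 q.2 τ‖ ≤ x} with hW
    have hWm : MeasurableSet W := measurableSet_noise_small q.1 q.2 _ x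
    -- The output is a union over permutations, so the noise need only be controlled for the one
    -- good permutation p.
    have hsub : fullCoeffSet k A ε ×ˢ W ⊆
        {x | ω j ∈ I.returned (κ * β) (signal ω x.1 x.2) r} := by
      rintro ⟨α, ν⟩ ⟨⟨hα1, hα2⟩, hν⟩
      have hαn : ‖α‖ = Real.sqrt A := by rw [← hα1, Real.sqrt_sq (norm_nonneg _)]
      obtain ⟨hloc, hcoeff⟩ := location_and_coeff_boxImpl (nPerm := nPerm) (ω := ω) (α := α)
        (ν := ν) (κ := κ) hB hBN hb hK hm hρ0 hρ hκ hβ (v := (y : ℝ) / 2) (by positivity)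
        (fun i => hαn ▸ PiLp.norm_apply_le α i) ha₀ hgain hleak hround hround' (r p).1 (r p).2.1
        (r p).2.2.1 (r p).2.2.2 j (hα2 j)
        (by rw [hσ, ha]; exact (Finset.mem_filter.1 hq).2.2)
        (fun i hi => by rw [hσ, ha]; exact le_natAbs_valMinAbs_of_mem_goodPairs hK hKy hq hi)
        t₀ ht (fun τ hτ => by rw [hσ]; exact (hν τ hτ).1)
        (fun τ hτ => by rw [hσ, ha]; exact (hν τ hτ).2)
      refine mem_returned_of_location p hloc hcoeff ?_
      rw [add_sub_cancel_right, ← mul_assoc, Units.inv_mul, one_mul]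
    refine le_trans ?_ (measure_mono hsub)
    rw [Measure.prod_prod, coeffLaw_fullCoeffSet hk hA hε, one_mul]
    have hWc : (Measure.pi fun _ : ZMod N => P) Wᶜ ≤ ENNReal.ofReal δ := by
      refine (measure_noise_large_le hP hv hBN q.1 q.2 _ hx0).trans (ENNReal.ofReal_le_ofReal ?_)
      refine le_trans (le_of_eq ?_) hδ
      simp only [samplePoints, List.length_cons, length_bisectTimes]
      push_cast
      ring
    have hδ0 : 0 ≤ δ := le_trans (by positivity) hδ
    rw [ENNReal.ofReal_sub _ hδ0, ENNReal.ofReal_one, tsub_le_iff_right]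
    calc (1 : ℝ≥0∞) = (Measure.pi fun _ : ZMod N => P) W + (Measure.pi fun _ : ZMod N => P) Wᶜ := by
          rw [measure_add_measure_compl hWm, measure_univ]
      _ ≤ _ := by gcongr

lemma detectionProb_le_one {N : ℕ} [NeZero N] (I : SFFTImpl N) (μ : ℝ) {k : ℕ} {A ε : ℝ}
    (hk : 1 ≤ k) (hA : 0 < A) (hε : ε < 1) (P : Measure ℂ) [IsProbabilityMeasure P]
    (ω : Fin k → ZMod N) (j : Fin k) : I.detectionProb μ A ε P ω j ≤ 1 := by
  have := isProbabilityMeasure_coeffLaw hk hA hε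
  rw [SFFTImpl.detectionProb]
  refine ENNReal.div_le_of_le_mul ?_
  rw [one_mul]
  calc _ ≤ ∑ _r : Fin I.nPerm → I.Draw, (1 : ℝ≥0∞) := Finset.sum_le_sum fun r _ => prob_le_one
    _ = _ := by simp

/-! ### The cost of the implementation -/

lemma length_bisect (N n M : ℕ) : (bisect N n M).length = 12 * n := by
  induction n generalizing M with
  | zero => rfl
  | succ n ih => rw [bisect, List.length_append, ih, bisectStep]; simp; ring

lemma countP_isSample_bisect (N n M : ℕ) : (bisect N n M).countP Instr.isSample = n := by
  induction n generalizing M with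
  | zero => rfl
  | succ n ih =>
    rw [bisect, List.countP_append, ih, bisectStep]
    simp [List.countP_cons, Instr.isSample]
    ring

/-- The registers are reused in every step, so their number does not grow with the length of the
program. -/
lemma dest_lt_of_mem_bisect {N n M : ℕ} {i : Instr N} (hi : i ∈ bisect N n M) :
    (∀ d ∈ i.idxDest, d < 4) ∧ ∀ d ∈ i.valDest, d < 4 := by
  induction n generalizing M with
  | zero => simp [bisect] at hi
  | succ n ih =>
    rw [bisect, List.mem_append] at hi
    rcases hi with hi | hi
    · simp only [bisectStep, List.mem_cons, List.not_mem_nil, or_false] at hi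
      rcases hi with rfl | rfl | rfl | rfl | rfl | rfl | rfl | rfl | rfl | rfl | rfl | rfl <;>
        simp [Instr.idxDest, Instr.valDest]
    · exact ih hi

lemma dest_lt_of_mem_locateProgram {N K n : ℕ} {i : Instr N} (hi : i ∈ locateProgram N K n) :
    (∀ d ∈ i.idxDest, d < 4) ∧ ∀ d ∈ i.valDest, d < 4 := by
  rw [locateProgram, List.mem_append] at hi
  rcases hi with hi | hi
  · simp only [List.mem_cons, List.not_mem_nil, or_false] at hi
    rcases hi with rfl | rfl | rfl <;> simp [Instr.idxDest, Instr.valDest]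
  · exact dest_lt_of_mem_bisect hi

lemma card_dest_le {N : ℕ} (l : List (Instr N)) (f : Instr N → Option ℕ)
    (h : ∀ i ∈ l, ∀ d ∈ f i, d < 4) : (l.filterMap f).toFinset.card ≤ 4 := by
  rw [← Finset.card_range 4]
  refine Finset.card_le_card fun d hd => ?_
  rw [List.mem_toFinset, List.mem_filterMap] at hd
  obtain ⟨i, hi, hd⟩ := hd
  exact Finset.mem_range.2 (h i hi d hd)

section Cost

variable {N : ℕ} [NeZero N] {nPerm B K m b : ℕ}

lemma nOne_boxImpl : (boxImpl N nPerm B K m b).nOne = 3 * m + 2 := by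
  have h : (boxImpl N nPerm B K m b).locate.countP Instr.isSample = 3 * m + 1 := by
    change (locateProgram N K (3 * m)).countP Instr.isSample = _
    rw [locateProgram, List.countP_append, countP_isSample_bisect]
    simp [List.countP_cons, Instr.isSample]
    ring
  rw [SFFTImpl.nOne, h]
  rfl

lemma samples_boxImpl_le : (boxImpl N nPerm B K m b).samples ≤ nPerm * ((3 * m + 2) * B) := by
  rw [SFFTImpl.samples, nOne_boxImpl]
  change nPerm * (1 * _) ≤ _
  rw [one_mul]
  gcongr
  exact nF_boxImpl_le

lemma operations_boxImpl_le : (boxImpl N nPerm B K m b).operations ≤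
    nPerm * (29 + 10 * Nat.clog 2 N + 36 * m + 10 * ((3 * m + 2) * B)) := by
  have hlen : (boxImpl N nPerm B K m b).locate.length = 3 + 36 * m := by
    change (locateProgram N K (3 * m)).length = _
    rw [locateProgram, List.length_append, length_bisect]
    simp
    ring
  rw [SFFTImpl.operations, nOne_boxImpl, hlen]
  change nPerm * (2 + 0 + 1 + 10 * (Nat.clog 2 N + 1) + 1 * (2 + (3 + 36 * m) +
    10 * ((3 * m + 2) * (boxImpl N nPerm B K m b).nF) + 5 * 1 + 4 + 2)) ≤ _
  have h : (3 * m + 2) * (boxImpl N nPerm B K m b).nF ≤ (3 * m + 2) * B :=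
    Nat.mul_le_mul_left _ nF_boxImpl_le
  refine Nat.mul_le_mul_left _ ?_
  omega

lemma size_le_self (n : ℕ) : Nat.size n ≤ n := Nat.size_le.2 Nat.lt_two_pow_self

lemma memoryBits_boxImpl_le : (boxImpl N nPerm B K m b).memoryBits ≤
    (21 + B + nPerm) * Nat.clog 2 N + (16 + B) * (4 * b + 4) + (nPerm + B + 2) := by
  rw [SFFTImpl.memoryBits]
  split_ifs
  · exact Nat.zero_le _
  have h1 : (boxImpl N nPerm B K m b).idxRegs ≤ 4 :=
    card_dest_le _ _ fun i hi => (dest_lt_of_mem_locateProgram hi).1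
  have h2 : (boxImpl N nPerm B K m b).valRegs ≤ 4 :=
    card_dest_le _ _ fun i hi => (dest_lt_of_mem_locateProgram hi).2
  have h3 : (boxImpl N nPerm B K m b).nF ≤ B := nF_boxImpl_le
  have h4 := size_le_self nPerm
  have h5 := (size_le_self (boxImpl N nPerm B K m b).nF).trans h3
  have h6 := size_le_self 1
  change (0 + 1 + _ + _ + nPerm * 1 + 16) * _ + (_ + _ + 12) * (2 * (2 * b + 2)) +
    (Nat.size nPerm + Nat.size 1 + Nat.size 1 + _) ≤ _
  refine Nat.add_le_add (Nat.add_le_add ?_ ?_) (by omega)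
  · exact Nat.mul_le_mul_right _ (by omega)
  · exact Nat.mul_le_mul (by omega) (by omega)

end Cost

/-! ### The choice of the parameters -/

/-- The integral part of the sixteenth root of `⌈log₂ N⌉`. -/
def scale (N : ℕ) : ℕ := (Nat.clog 2 N).sqrt.sqrt.sqrt.sqrt

lemma scale_pow_le (N : ℕ) : scale N ^ 16 ≤ Nat.clog 2 N := by
  have h1 := Nat.sqrt_le' (Nat.clog 2 N)
  have h2 := Nat.sqrt_le' (Nat.clog 2 N).sqrt
  have h3 := Nat.sqrt_le' (Nat.clog 2 N).sqrt.sqrt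
  have h4 := Nat.sqrt_le' (Nat.clog 2 N).sqrt.sqrt.sqrt
  calc scale N ^ 16 = (((scale N ^ 2) ^ 2) ^ 2) ^ 2 := by ring
    _ ≤ ((((Nat.clog 2 N).sqrt.sqrt.sqrt) ^ 2) ^ 2) ^ 2 := by gcongr; exact h4
    _ ≤ (((Nat.clog 2 N).sqrt.sqrt) ^ 2) ^ 2 := by gcongr
    _ ≤ ((Nat.clog 2 N).sqrt) ^ 2 := by gcongr
    _ ≤ _ := h1

lemma clog_le_scale (N : ℕ) : Nat.clog 2 N ≤ (scale N + 1) ^ 16 := by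
  have h1 := (Nat.lt_succ_sqrt' (Nat.clog 2 N)).le
  have h2 : (Nat.clog 2 N).sqrt + 1 ≤ _ := Nat.lt_succ_sqrt' (Nat.clog 2 N).sqrt
  have h3 : (Nat.clog 2 N).sqrt.sqrt + 1 ≤ _ := Nat.lt_succ_sqrt' (Nat.clog 2 N).sqrt.sqrt
  have h4 : (Nat.clog 2 N).sqrt.sqrt.sqrt + 1 ≤ _ :=
    Nat.lt_succ_sqrt' (Nat.clog 2 N).sqrt.sqrt.sqrt
  calc Nat.clog 2 N ≤ ((Nat.clog 2 N).sqrt + 1) ^ 2 := h1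
    _ ≤ (((Nat.clog 2 N).sqrt.sqrt + 1) ^ 2) ^ 2 := by gcongr
    _ ≤ ((((Nat.clog 2 N).sqrt.sqrt.sqrt + 1) ^ 2) ^ 2) ^ 2 := by gcongr
    _ ≤ ((((scale N + 1) ^ 2) ^ 2) ^ 2) ^ 2 := by gcongr; exact h4
    _ = _ := by ring

lemma clog_le_mul_scale_pow {N : ℕ} (hq : 1 ≤ scale N) :
    Nat.clog 2 N ≤ 2 ^ 16 * scale N ^ 16 := by
  refine (clog_le_scale N).trans ?_
  rw [← mul_pow]
  gcongr
  omega

lemma scale_pow_le_self (N : ℕ) : scale N ^ 16 ≤ N := by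
  refine (scale_pow_le N).trans ?_
  rw [Nat.clog_le_iff_le_pow one_lt_two]
  exact Nat.lt_two_pow_self.le

lemma tendsto_scale : Tendsto (fun N : ℕ+ => ((scale (N : ℕ) : ℕ) : ℝ)) atTop atTop := by
  refine tendsto_natCast_atTop_atTop.comp ?_
  rw [tendsto_atTop]
  intro c
  filter_upwards [eventually_ge_atTop (⟨2 ^ (c + 1) ^ 16, by positivity⟩ : ℕ+)] with N hN
  have hN' : 2 ^ (c + 1) ^ 16 ≤ (N : ℕ) := hN
  have h1 : (c + 1) ^ 16 ≤ Nat.clog 2 N := by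
    have := Nat.clog_mono_right 2 hN'
    rwa [Nat.clog_pow _ _ one_lt_two] at this
  have h2 := h1.trans (clog_le_scale N)
  have h3 := (Nat.pow_le_pow_iff_left (by norm_num)).1 h2
  omega

/-- The implementation on `ℤ_N` for large `N`. -/
def sfft (N : ℕ) [NeZero N] : SFFTImpl N :=
  -- With q = `scale N`: BK ≤ N/q makes the gain near 1, separation N/q^9 makes the leakage at most
  -- 2/q, q^12 trials exceed 1/(success probability) ≈ q^11, and 2ℓ bits make the rounding unit at
  -- most N^(-2).
  boxImpl N (scale N ^ 12) (scale N ^ 10) (N / scale N ^ 11) (Nat.clog 2 N) (2 * Nat.clog 2 N)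

lemma cost_sfft_le {N : ℕ} [NeZero N] (hq : 1 ≤ scale N) :
    (sfft N).samples ≤ 400 * (Nat.clog 2 N * scale N ^ 22) ∧
      (sfft N).memoryBits ≤ 400 * (Nat.clog 2 N * scale N ^ 22) ∧
      (sfft N).operations ≤ 400 * (Nat.clog 2 N * scale N ^ 22) := by
  have hl : 1 ≤ Nat.clog 2 N := (Nat.one_le_pow _ _ hq).trans (scale_pow_le N)
  have hs := samples_boxImpl_le (N := N) (nPerm := scale N ^ 12) (B := scale N ^ 10)
    (K := N / scale N ^ 11) (m := Nat.clog 2 N) (b := 2 * Nat.clog 2 N)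
  have hmem := memoryBits_boxImpl_le (N := N) (nPerm := scale N ^ 12) (B := scale N ^ 10)
    (K := N / scale N ^ 11) (m := Nat.clog 2 N) (b := 2 * Nat.clog 2 N)
  have hop := operations_boxImpl_le (N := N) (nPerm := scale N ^ 12) (B := scale N ^ 10)
    (K := N / scale N ^ 11) (m := Nat.clog 2 N) (b := 2 * Nat.clog 2 N)
  rw [sfft]
  set ℓ := Nat.clog 2 N
  set q := scale N
  have e22 : q ^ 22 = q ^ 12 * q ^ 10 := by ring
  have hB : 1 ≤ q ^ 10 := Nat.one_le_pow _ _ hq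
  have hP : 1 ≤ q ^ 12 := Nat.one_le_pow _ _ hq
  have hℓB : ℓ ≤ ℓ * q ^ 10 := Nat.le_mul_of_pos_right _ hB
  have hℓB' : q ^ 10 ≤ ℓ * q ^ 10 := Nat.le_mul_of_pos_left _ hl
  have hX : ℓ * q ^ 10 ≤ q ^ 12 * (ℓ * q ^ 10) := Nat.le_mul_of_pos_left _ hP
  have hPl : q ^ 12 * ℓ ≤ q ^ 12 * (ℓ * q ^ 10) := Nat.mul_le_mul_left _ hℓB
  have hPl' : q ^ 12 ≤ q ^ 12 * ℓ := Nat.le_mul_of_pos_right _ hl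
  have eX : ℓ * q ^ 22 = q ^ 12 * (ℓ * q ^ 10) := by ring
  rw [eX]
  refine ⟨hs.trans ?_, hmem.trans ?_, hop.trans ?_⟩
  · have : (3 * ℓ + 2) * q ^ 10 ≤ 5 * (ℓ * q ^ 10) := by nlinarith
    calc _ ≤ q ^ 12 * (5 * (ℓ * q ^ 10)) := Nat.mul_le_mul_left _ this
      _ = 5 * (q ^ 12 * (ℓ * q ^ 10)) := by ring
      _ ≤ _ := by omega
  · have : (21 + q ^ 10 + q ^ 12) * ℓ + (16 + q ^ 10) * (4 * (2 * ℓ) + 4) + (q ^ 12 + q ^ 10 + 2) =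
        21 * ℓ + ℓ * q ^ 10 + q ^ 12 * ℓ + 128 * ℓ + 64 + 8 * (ℓ * q ^ 10) + 4 * q ^ 10 + q ^ 12 +
          q ^ 10 + 2 := by ring
    rw [this]
    omega
  · have : 29 + 10 * ℓ + 36 * ℓ + 10 * ((3 * ℓ + 2) * q ^ 10) ≤ 200 * (ℓ * q ^ 10) := by nlinarith
    calc _ ≤ q ^ 12 * (200 * (ℓ * q ^ 10)) := Nat.mul_le_mul_left _ this
      _ = 200 * (q ^ 12 * (ℓ * q ^ 10)) := by ring
      _ ≤ _ := by omega

lemma clog_le_four_mul_log {N : ℕ} (h : 2 ≤ Nat.clog 2 N) :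
    (Nat.clog 2 N : ℝ) ≤ 4 * Real.log N := by
  have hN : 1 < N := by
    by_contra hcon
    rw [Nat.clog_of_right_le_one (by omega)] at h
    omega
  have h1 : (2 : ℝ) ^ (Nat.clog 2 N - 1) ≤ N := by
    exact_mod_cast (Nat.pow_pred_clog_lt_self one_lt_two hN).le
  have h2 := Real.log_le_log (by positivity) h1
  rw [Real.log_pow, Nat.cast_sub (by omega)] at h2
  have h3 : (2 : ℝ) ≤ Nat.clog 2 N := by exact_mod_cast h
  have := Real.log_two_gt_d9
  push_cast at h2
  nlinarith

/-- Upper bound for the probability that the noise is large. -/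
def noiseBound (c₁ c₂ q : ℝ) : ℝ :=
  2 ^ 19 * 5 * q ^ 16 * (q ^ 10 * Real.exp (-(c₁ * q)) + Real.exp (-(c₂ * q)))

lemma tendsto_noiseBound {c₁ c₂ : ℝ} (h₁ : 0 < c₁) (h₂ : 0 < c₂) :
    Tendsto (noiseBound c₁ c₂) atTop (𝓝 0) := by
  have key : ∀ (c : ℝ) (n : ℕ), 0 < c → Tendsto (fun q : ℝ => q ^ n * Real.exp (-(c * q))) atTop (𝓝 0) := by
    intro c n hc
    have := Real.tendsto_pow_mul_exp_neg_atTop_nhds_zero n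
    have h := (this.comp (tendsto_id.const_mul_atTop hc)).const_mul ((c ^ n)⁻¹)
    rw [mul_zero] at h
    refine h.congr fun q => ?_
    simp only [Function.comp_apply, id, mul_pow]
    field_simp
  have h := ((key c₁ 26 h₁).add (key c₂ 16 h₂)).const_mul (2 ^ 19 * 5)
  rw [add_zero, mul_zero] at h
  refine h.congr fun q => ?_
  rw [noiseBound]
  ring

lemma card_primeFactors_le_clog (N : ℕ) [NeZero N] : N.primeFactors.card ≤ Nat.clog 2 N := by
  have h := (two_pow_card_primeFactors_le (NeZero.ne N)).trans (Nat.le_pow_clog one_lt_two N)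
  exact (Nat.pow_le_pow_iff_right one_lt_two).1 h

/-- At most ℓ ≤ 2^16 q^16 prime factors give N ≤ 2^10 q^8 φ(N), and 4 · 2^10 · k ≤ q absorbs the
constant and k. -/
lemma four_mul_mul_le_totient {N k : ℕ} [NeZero N] (hq : 1 ≤ scale N)
    (hk : 2 ^ 12 * k ≤ scale N) : 4 * k * (N / scale N ^ 9) ≤ N.totient := by
  set q := scale N
  have hr : (N.primeFactors.card : ℝ) ≤ 2 ^ 16 * (q : ℝ) ^ 16 := by
    exact_mod_cast (card_primeFactors_le_clog N).trans (clog_le_mul_scale_pow hq)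
  have hq' : (1 : ℝ) ≤ q := by exact_mod_cast hq
  have hq16 : (1 : ℝ) ≤ (q : ℝ) ^ 16 := one_le_pow₀ hq'
  have htot := sq_le_totient_sq_mul N
  have hN : (0 : ℝ) < N := Nat.cast_pos.2 (NeZero.pos N)
  have hk' : (2 ^ 12 * (k : ℝ)) ^ 2 ≤ (q : ℝ) ^ 2 := by
    have : 2 ^ 12 * (k : ℝ) ≤ q := by exact_mod_cast hk
    gcongr
  have h1 : (N : ℝ) ^ 2 ≤ 2 ^ 20 * (q : ℝ) ^ 16 * (N.totient : ℝ) ^ 2 := by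
    refine htot.trans (mul_le_mul_of_nonneg_right ?_ (sq_nonneg _))
    linarith
  have h2 : (4 * (k : ℝ) * N) ^ 2 ≤ ((q : ℝ) ^ 9 * N.totient) ^ 2 := by
    calc (4 * (k : ℝ) * N) ^ 2 = 16 * (k : ℝ) ^ 2 * (N : ℝ) ^ 2 := by ring
      _ ≤ 16 * (k : ℝ) ^ 2 * (2 ^ 20 * (q : ℝ) ^ 16 * (N.totient : ℝ) ^ 2) := by gcongr
      _ = (2 ^ 12 * (k : ℝ)) ^ 2 * ((q : ℝ) ^ 16 * (N.totient : ℝ) ^ 2) := by ring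
      _ ≤ (q : ℝ) ^ 2 * ((q : ℝ) ^ 16 * (N.totient : ℝ) ^ 2) := by gcongr
      _ = _ := by ring
  have h3 : 4 * (k : ℝ) * N ≤ (q : ℝ) ^ 9 * N.totient :=
    (pow_le_pow_iff_left₀ (by positivity) (by positivity) two_ne_zero).1 h2
  have h4 : 4 * k * N ≤ q ^ 9 * N.totient := by exact_mod_cast h3
  have hq9 : 0 < q ^ 9 := pow_pos hq 9
  refine Nat.le_of_mul_le_mul_left (le_trans ?_ h4) hq9
  calc q ^ 9 * (4 * k * (N / q ^ 9)) = 4 * k * (q ^ 9 * (N / q ^ 9)) := by ring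
    _ ≤ 4 * k * N := Nat.mul_le_mul_left _ (Nat.mul_div_le N _)

/-- A quotient of at least 1 is at least halved by rounding down; this is the lower bound for K and
y. -/
lemma half_le_natCast_div {a b : ℕ} (hb : 0 < b) (h : b ≤ a) :
    (a : ℝ) / (2 * b) ≤ ((a / b : ℕ) : ℝ) := by
  have h1 : 1 ≤ a / b := (Nat.one_le_div_iff hb).2 h
  have h2 := Nat.div_add_mod a b
  have h3 := Nat.mod_lt a hb
  have h4 : b ≤ b * (a / b) := Nat.le_mul_of_pos_right _ h1
  rw [div_le_iff₀ (by positivity)]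
  have : a ≤ a / b * (2 * b) := by nlinarith
  exact_mod_cast this

set_option maxHeartbeats 1000000 in
lemma le_detectionProb_sfft {N : ℕ} [NeZero N] {k : ℕ} {A ε s ρ κ : ℝ}
    (hk : 1 ≤ k) (hA : 0 < A) (hε₀ : 0 < ε) (hε : ε < 1) (hs : 0 < s)
    (hρ0 : 0 < ρ) (hρ : ρ ≤ 1 / 200) (hκ : κ ≤ 1 - 5 * ρ)
    (h1 : 2 ≤ scale N) (h2 : 2 ^ 12 * k ≤ scale N) (h3 : (k + 4) ^ 2 * A ≤ scale N)
    (h4 : 2 * Real.pi ≤ ρ * scale N)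
    (h5 : 2 * (k * Real.sqrt A) ≤ ρ * (ε * Real.sqrt (A / k)) * scale N)
    (h6 : 12 ≤ ρ * (ε * Real.sqrt (A / k)) * scale N)
    (h7 : 800 ≤ (ε * Real.sqrt (A / k)) ^ 2 * scale N)
    (h8 : noiseBound (1 / (8 * s ^ 2)) ((ρ * (ε * Real.sqrt (A / k))) ^ 2 / (8 * s ^ 2)) (scale N)
      ≤ 1)
    {P : Measure ℂ} (hP : IsSubgaussianNoise P (s ^ 2 / N)) {ω : Fin k → ZMod N}
    (hω : Function.Injective ω) (j : Fin k) :
    ENNReal.ofReal ((1 - noiseBound (1 / (8 * s ^ 2))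
      ((ρ * (ε * Real.sqrt (A / k))) ^ 2 / (8 * s ^ 2)) (scale N)) *
        (1 - Real.exp (-((scale N : ℝ) / 2)))) ≤
      (sfft N).detectionProb (κ * (ε * Real.sqrt (A / k))) A ε P ω j := by
  have hℓ : Nat.clog 2 N ≤ 2 ^ 16 * scale N ^ 16 := clog_le_mul_scale_pow (by omega)
  have hqN := scale_pow_le_self N
  have htot := four_mul_mul_le_totient (N := N) (by omega) h2
  have hNℓ := Nat.le_pow_clog one_lt_two N
  rw [sfft]
  set q := scale N
  set ℓ := Nat.clog 2 N
  set β := ε * Real.sqrt (A / k)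
  have hN0 := NeZero.pos N
  have hN : (0 : ℝ) < N := Nat.cast_pos.2 hN0
  have hN1 : (1 : ℝ) ≤ N := by exact_mod_cast hN0
  have hq2 : (2 : ℝ) ≤ q := by exact_mod_cast h1
  have hq0 : (0 : ℝ) < q := by linarith
  have hq1 : (1 : ℝ) ≤ q := by linarith
  have hβ : 0 < β := mul_pos hε₀ (Real.sqrt_pos.2 (div_pos hA (by exact_mod_cast hk)))
  have hpow : ∀ n ≤ 16, q ^ n ≤ N := fun n hn => (Nat.pow_le_pow_right (by omega) hn).trans hqN
  have hqN1 : (q : ℝ) ≤ N := by exact_mod_cast (pow_one q ▸ hpow 1 (by norm_num))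
  have hqN' : (q : ℝ) ^ 16 ≤ N := by exact_mod_cast hqN
  have hq11 : 0 < q ^ 11 := pow_pos (by omega) _
  have hq9 : 0 < q ^ 9 := pow_pos (by omega) _
  have hKN : q ^ 11 * (N / q ^ 11) ≤ N := Nat.mul_div_le N _
  have hKN' : (q : ℝ) ^ 11 * ((N / q ^ 11 : ℕ) : ℝ) ≤ N := by exact_mod_cast hKN
  have h4K : 4 * (N / q ^ 11) ≤ N := by
    refine le_trans (Nat.mul_le_mul_right _ ?_) hKN
    calc 4 = 2 ^ 2 := by norm_num
      _ ≤ 2 ^ 11 := by norm_num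
      _ ≤ q ^ 11 := Nat.pow_le_pow_left h1 11
  have hm : 2 * (N / q ^ 11) < 2 ^ ℓ := by omega
  have hy0 : 0 < N / q ^ 9 := Nat.div_pos (hpow 9 (by norm_num)) hq9
  have hKy : 2 * (N / q ^ 11) ≤ N / q ^ 9 := by
    rw [Nat.le_div_iff_mul_le hq9]
    refine le_trans ?_ hKN
    calc 2 * (N / q ^ 11) * q ^ 9 = 2 * q ^ 9 * (N / q ^ 11) := by ring
      _ ≤ q ^ 11 * (N / q ^ 11) := by
        refine Nat.mul_le_mul_right _ ?_
        calc 2 * q ^ 9 ≤ q * q * q ^ 9 := Nat.mul_le_mul_right _ (h1.trans (Nat.le_mul_self q))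
          _ = q ^ 11 := by ring
  have h2b : (N : ℝ) ^ 2 ≤ 2 ^ (2 * ℓ) := by
    have : (N : ℝ) ≤ 2 ^ ℓ := by exact_mod_cast hNℓ
    rw [mul_comm 2 ℓ, pow_mul]
    gcongr
  have hη : ((2 : ℝ) ^ (2 * ℓ))⁻¹ ≤ ((N : ℝ) ^ 2)⁻¹ := inv_anti₀ (by positivity) h2b
  have hNN : (N : ℝ) ≤ (N : ℝ) ^ 2 := le_self_pow₀ hN1 two_ne_zero
  have hsq : Real.sqrt N ≤ N := by
    rw [Real.sqrt_le_left hN.le]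
    exact hNN
  have hBq : (q : ℝ) ^ 10 * q ≤ N := by
    calc (q : ℝ) ^ 10 * q = (q : ℝ) ^ 11 := by ring
      _ ≤ (q : ℝ) ^ 16 := pow_le_pow_right₀ hq1 (by norm_num)
      _ ≤ N := hqN'
  have hb : 16 * ((q ^ 10 : ℕ) : ℝ) ≤ 2 ^ (2 * ℓ) := by
    push_cast
    calc 16 * (q : ℝ) ^ 10 = 2 ^ 4 * (q : ℝ) ^ 10 := by norm_num
      _ ≤ (q : ℝ) ^ 4 * (q : ℝ) ^ 10 := by gcongr
      _ = (q : ℝ) ^ 14 := by ring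
      _ ≤ (q : ℝ) ^ 16 := pow_le_pow_right₀ hq1 (by norm_num)
      _ ≤ N := hqN'
      _ ≤ (N : ℝ) ^ 2 := hNN
      _ ≤ _ := h2b
  have ha₀ : (k + 4) * Real.sqrt A ≤ Real.sqrt N := by
    refine Real.le_sqrt_of_sq_le ?_
    rw [mul_pow, Real.sq_sqrt hA.le]
    exact h3.trans hqN1
  have hgain : 2 * Real.pi * ((N / q ^ 11 : ℕ) : ℝ) * ((q ^ 10 : ℕ) : ℝ) / N ≤ ρ := by
    rw [div_le_iff₀ hN]
    push_cast
    calc 2 * Real.pi * ((N / q ^ 11 : ℕ) : ℝ) * (q : ℝ) ^ 10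
        ≤ ρ * q * ((N / q ^ 11 : ℕ) : ℝ) * (q : ℝ) ^ 10 := by gcongr
      _ = ρ * ((q : ℝ) ^ 11 * ((N / q ^ 11 : ℕ) : ℝ)) := by ring
      _ ≤ ρ * N := by gcongr
  have hyl : (N : ℝ) / (2 * (q : ℝ) ^ 9) ≤ ((N / q ^ 9 : ℕ) : ℝ) := by
    have := half_le_natCast_div hq9 (hpow 9 (by norm_num))
    exact_mod_cast this
  have hKl : (N : ℝ) / (2 * (q : ℝ) ^ 11) ≤ ((N / q ^ 11 : ℕ) : ℝ) := by
    have := half_le_natCast_div hq11 (hpow 11 (by norm_num))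
    exact_mod_cast this
  have hleak : k * Real.sqrt A * (N / (2 * ((q ^ 10 : ℕ) : ℝ) * (((N / q ^ 9 : ℕ) : ℝ) / 2))) ≤
      ρ * β := by
    push_cast
    have e : (N : ℝ) / (2 * (q : ℝ) ^ 10 * (((N / q ^ 9 : ℕ) : ℝ) / 2)) ≤ 2 / (q : ℝ) := by
      calc (N : ℝ) / (2 * (q : ℝ) ^ 10 * (((N / q ^ 9 : ℕ) : ℝ) / 2))
          ≤ (N : ℝ) / (2 * (q : ℝ) ^ 10 * ((N : ℝ) / (2 * (q : ℝ) ^ 9) / 2)) := by gcongr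
        _ = 2 / (q : ℝ) := by field_simp
    calc k * Real.sqrt A * ((N : ℝ) / (2 * (q : ℝ) ^ 10 * (((N / q ^ 9 : ℕ) : ℝ) / 2)))
        ≤ k * Real.sqrt A * (2 / (q : ℝ)) := by gcongr
      _ = 2 * (k * Real.sqrt A) / q := by ring
      _ ≤ _ := by rwa [div_le_iff₀ hq0]
  have hround : 12 * ((q ^ 10 : ℕ) : ℝ) * ((2 : ℝ) ^ (2 * ℓ))⁻¹ * Real.sqrt N ≤ ρ * β := by
    push_cast
    calc 12 * (q : ℝ) ^ 10 * ((2 : ℝ) ^ (2 * ℓ))⁻¹ * Real.sqrt N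
        ≤ 12 * (q : ℝ) ^ 10 * ((N : ℝ) ^ 2)⁻¹ * N := by gcongr
      _ = 12 * (q : ℝ) ^ 10 / N := by field_simp
      _ ≤ ρ * β * q * (q : ℝ) ^ 10 / N := by gcongr
      _ = ρ * β * ((q : ℝ) ^ 10 * q / N) := by ring
      _ ≤ ρ * β * 1 := by
        gcongr
        rwa [div_le_one hN]
      _ = ρ * β := mul_one _
  have hround' : 800 * ((2 : ℝ) ^ (2 * ℓ))⁻¹ * N ≤ β ^ 2 := by
    calc 800 * ((2 : ℝ) ^ (2 * ℓ))⁻¹ * N ≤ β ^ 2 * q * ((N : ℝ) ^ 2)⁻¹ * N := by gcongr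
      _ = β ^ 2 * (q / N) := by field_simp
      _ ≤ β ^ 2 * 1 := by
        gcongr
        rwa [div_le_one hN]
      _ = β ^ 2 := mul_one _
  have hq10 : (q : ℝ) ≤ (q : ℝ) ^ 10 := le_self_pow₀ hq1 (by norm_num)
  -- The true exponents are proportional to N and q^10. Replacing both by q is enough against the
  -- polynomial factors.
  have hδ : (3 * ℓ + 2) * (4 * (((q ^ 10 : ℕ) : ℝ) * Real.exp (-1 / (8 * (s ^ 2 / N))) +
      Real.exp (-(((q ^ 10 : ℕ) : ℝ) * (ρ * β / Real.sqrt N)) ^ 2 /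
        (8 * (((q ^ 10 : ℕ) : ℝ) * (s ^ 2 / N)))))) ≤
      noiseBound (1 / (8 * s ^ 2)) ((ρ * β) ^ 2 / (8 * s ^ 2)) q := by
    push_cast
    have hℓ' : (3 * (ℓ : ℝ) + 2) * 4 ≤ 2 ^ 19 * 5 * (q : ℝ) ^ 16 := by
      have h : (ℓ : ℝ) ≤ 2 ^ 16 * (q : ℝ) ^ 16 := by exact_mod_cast hℓ
      have : (1 : ℝ) ≤ (q : ℝ) ^ 16 := one_le_pow₀ hq1
      linarith
    have e1 : -1 / (8 * (s ^ 2 / N)) ≤ -(1 / (8 * s ^ 2) * (q : ℝ)) := by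
      have : -1 / (8 * (s ^ 2 / N)) = -(1 / (8 * s ^ 2) * (N : ℝ)) := by field_simp
      rw [this]
      gcongr
    have e2 : -((q : ℝ) ^ 10 * (ρ * β / Real.sqrt N)) ^ 2 / (8 * ((q : ℝ) ^ 10 * (s ^ 2 / N))) ≤
        -((ρ * β) ^ 2 / (8 * s ^ 2) * (q : ℝ)) := by
      have : -((q : ℝ) ^ 10 * (ρ * β / Real.sqrt N)) ^ 2 / (8 * ((q : ℝ) ^ 10 * (s ^ 2 / N))) =
          -((ρ * β) ^ 2 / (8 * s ^ 2) * (q : ℝ) ^ 10) := by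
        rw [mul_pow, div_pow, Real.sq_sqrt hN.le]
        field_simp
      rw [this]
      gcongr
    rw [noiseBound, ← mul_assoc]
    gcongr
  refine le_trans (ENNReal.ofReal_le_ofReal ?_) (le_detectionProb_boxImpl hk hA hε₀ hε hs
    (pow_pos (by omega) _) (hpow 10 (by norm_num)) hb h4K hm hρ0 hρ hκ hy0 hKy htot ha₀ hgain
    hleak hround hround' h8 hδ hP hω j)
  -- The expected number of good draws: q^12 trials of success probability at least 1/(2q^11).
  have he : (q : ℝ) / 2 ≤ ((q ^ 12 : ℕ) : ℝ) * (((N / q ^ 11 : ℕ) : ℝ) / N) := by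
    push_cast
    calc (q : ℝ) / 2 = (q : ℝ) ^ 12 * ((N : ℝ) / (2 * (q : ℝ) ^ 11) / N) := by field_simp
      _ ≤ _ := by gcongr
  have : 0 ≤ 1 - noiseBound (1 / (8 * s ^ 2)) ((ρ * β) ^ 2 / (8 * s ^ 2)) q := by linarith
  gcongr

/-- The implementation without any permutation. -/
def trivialImpl (N : ℕ) [NeZero N] : SFFTImpl N := boxImpl N 0 0 0 0 0

lemma cost_trivialImpl (N : ℕ) [NeZero N] : (trivialImpl N).samples = 0 ∧
    (trivialImpl N).memoryBits = 0 ∧ (trivialImpl N).operations = 0 := by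
  refine ⟨?_, if_pos rfl, ?_⟩
  · exact Nat.zero_mul _
  · exact Nat.zero_mul _

/-- All three costs of `I` are at most `x`. -/
def CostLe {N : ℕ} [NeZero N] (I : SFFTImpl N) (x : ℝ) : Prop :=
  (I.samples : ℝ) ≤ x ∧ (I.memoryBits : ℝ) ≤ x ∧ (I.operations : ℝ) ≤ x

/-- The constant 25600 is 400 · 4³, from the cost bound and from ℓ ≤ 4 log N. -/
lemma costLe_sfft {N : ℕ} [NeZero N] {R : ℝ} (hq : 2 ≤ scale N)
    (hR : 25600 ≤ R * scale N) : CostLe (sfft N) (R * Real.log N ^ 3) := by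
  have hℓ := scale_pow_le N
  have hcost := cost_sfft_le (N := N) (by omega)
  set q := scale N
  set ℓ := Nat.clog 2 N
  have hq1 : (1 : ℝ) ≤ q := by exact_mod_cast (show 1 ≤ q by omega)
  have h2ℓ : 2 ≤ ℓ := hq.trans ((Nat.le_self_pow (by norm_num) q).trans hℓ)
  have hR0 : 0 < R := by
    have : 0 < R * q := by linarith
    exact pos_of_mul_pos_left this (by linarith)
  have hlog := clog_le_four_mul_log h2ℓ
  have hℓ0 : (0 : ℝ) ≤ ℓ := Nat.cast_nonneg _
  have hℓ' : (q : ℝ) ^ 16 ≤ ℓ := by exact_mod_cast hℓ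
  have key : 400 * ((ℓ : ℝ) * (q : ℝ) ^ 22) ≤ R * Real.log N ^ 3 := by
    have h1 : (ℓ : ℝ) ^ 3 ≤ (4 * Real.log N) ^ 3 := by gcongr
    have h2 : ((q : ℝ) ^ 16) ^ 2 ≤ (ℓ : ℝ) ^ 2 := by gcongr
    have h3 : (q : ℝ) ^ 23 ≤ ((q : ℝ) ^ 16) ^ 2 := by
      rw [← pow_mul]
      exact pow_le_pow_right₀ hq1 (by norm_num)
    calc 400 * ((ℓ : ℝ) * (q : ℝ) ^ 22) = 25600 * (ℓ * (q : ℝ) ^ 22) / 64 := by ring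
      _ ≤ R * q * (ℓ * (q : ℝ) ^ 22) / 64 := by gcongr
      _ = R * (ℓ * (q : ℝ) ^ 23) / 64 := by ring
      _ ≤ R * (ℓ * (ℓ : ℝ) ^ 2) / 64 := by gcongr; exact h3.trans h2
      _ = R * (ℓ : ℝ) ^ 3 / 64 := by ring
      _ ≤ R * (4 * Real.log N) ^ 3 / 64 := by gcongr
      _ = _ := by ring
  refine ⟨le_trans ?_ key, le_trans ?_ key, le_trans ?_ key⟩
  · exact_mod_cast hcost.1
  · exact_mod_cast hcost.2.1
  · exact_mod_cast hcost.2.2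

open Classical in
/-- `sfft` if its cost is at most `R log³ N`, and the trivial implementation otherwise. -/
def budgetImpl (R : ℝ) (N : ℕ) [NeZero N] : SFFTImpl N :=
  if CostLe (sfft N) (R * Real.log N ^ 3) then sfft N else trivialImpl N

lemma costLe_budgetImpl {R : ℝ} (hR : 0 ≤ R) (N : ℕ) [NeZero N] :
    CostLe (budgetImpl R N) (R * Real.log N ^ 3) := by
  rw [budgetImpl]
  split_ifs with h
  · exact h
  · obtain ⟨h1, h2, h3⟩ := cost_trivialImpl N
    have : 0 ≤ R * Real.log N ^ 3 := mul_nonneg hR (pow_nonneg (Real.log_natCast_nonneg N) 3)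
    rw [CostLe, h1, h2, h3, Nat.cast_zero]
    exact ⟨this, this, this⟩

lemma tendsto_detectionProb_budgetImpl {k : ℕ} {A ε s κ R : ℝ} (hκ₁ : κ < 1) (hR : 0 < R)
    (hk : 1 ≤ k) (hA : 0 < A) (hε₀ : 0 < ε) (hε : ε < 1) (hs : 0 < s) {P : ℕ+ → Measure ℂ}
    (hP : ∀ N : ℕ+, IsSubgaussianNoise (P N) (s ^ 2 / (N : ℕ)))
    {ω : (N : ℕ+) → Fin k → ZMod (N : ℕ)} (hω : ∀ᶠ N : ℕ+ in atTop, Function.Injective (ω N))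
    (j : Fin k) :
    Tendsto (fun N : ℕ+ => (budgetImpl R (N : ℕ)).detectionProb (κ * (ε * Real.sqrt (A / k))) A ε
      (P N) (ω N) j) atTop (𝓝 1) := by
  -- The margin 1 - κ is split into five equal shares, capped for the bisection.
  set ρ : ℝ := min (1 / 200) ((1 - κ) / 5) with hρdef
  have hρ0 : 0 < ρ := lt_min (by norm_num) (by linarith)
  have hρ : ρ ≤ 1 / 200 := min_le_left _ _
  have hκ : κ ≤ 1 - 5 * ρ := by
    have : ρ ≤ (1 - κ) / 5 := min_le_right _ _
    linarith
  set β := ε * Real.sqrt (A / k)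
  have hβ : 0 < β := mul_pos hε₀ (Real.sqrt_pos.2 (div_pos hA (by exact_mod_cast hk)))
  set δ : ℝ → ℝ := noiseBound (1 / (8 * s ^ 2)) ((ρ * β) ^ 2 / (8 * s ^ 2))
  have hδ : Tendsto δ atTop (𝓝 0) := tendsto_noiseBound (by positivity) (by positivity)
  have hexp : Tendsto (fun q : ℝ => Real.exp (-(q / 2))) atTop (𝓝 0) :=
    Real.tendsto_exp_neg_atTop_nhds_zero.comp (tendsto_id.atTop_div_const two_pos)
  have hlow : Tendsto (fun q : ℝ => ENNReal.ofReal ((1 - δ q) * (1 - Real.exp (-(q / 2))))) atTop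
      (𝓝 1) := by
    have h := (hδ.const_sub 1).mul (hexp.const_sub 1)
    have h' := ENNReal.tendsto_ofReal h
    simpa using h'
  have hlin : ∀ c x : ℝ, 0 < c → ∀ᶠ N : ℕ+ in atTop, x ≤ c * (scale (N : ℕ) : ℝ) := fun c x hc =>
    (tendsto_scale.const_mul_atTop hc).eventually_ge_atTop x
  refine tendsto_of_tendsto_of_tendsto_of_le_of_le' (hlow.comp tendsto_scale) tendsto_const_nhds
    ?_ (Eventually.of_forall fun N => ?_)
  · filter_upwards [hω, tendsto_scale.eventually_ge_atTop 2,
      tendsto_scale.eventually_ge_atTop (2 ^ 12 * k),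
      tendsto_scale.eventually_ge_atTop ((k + 4) ^ 2 * A), hlin ρ (2 * Real.pi) hρ0,
      hlin (ρ * β) (2 * (k * Real.sqrt A)) (by positivity), hlin (ρ * β) 12 (by positivity),
      hlin (β ^ 2) 800 (by positivity), hlin R 25600 hR,
      (hδ.comp tendsto_scale).eventually_le_const zero_lt_one] with
      N hωN h1 h2 h3 h4 h5 h6 h7 hRN h8
    have h1' : 2 ≤ scale (N : ℕ) := by exact_mod_cast h1
    rw [budgetImpl, if_pos (costLe_sfft h1' hRN)]
    exact le_detectionProb_sfft hk hA hε₀ hε hs hρ0 hρ hκ h1' (by exact_mod_cast h2) h3 h4 h5 h6 h7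
      h8 (hP N) hωN j
  · have := (hP N).isProbabilityMeasure
    exact detectionProb_le_one _ _ hk hA hε _ _ _

end SparseFourier

end

theorem mainTheorem2 (κ : ℝ) (hκ₀ : 0 < κ) (hκ₁ : κ < 1) :
    ∃ c₁ c₂ c₃ : ℝ, 0 < c₁ ∧ 0 < c₂ ∧ 0 < c₃ ∧
      ∀ (k : ℕ) (A ε s : ℝ), 1 ≤ k → 0 < A → 0 < ε → ε < 1 → 0 < s →
        let SNR : ℝ := A / s ^ 2
        let μ : ℝ := κ * (ε * Real.sqrt (A / k))
        ∃ I : (N : ℕ+) → SparseFourier.SFFTImpl (N : ℕ),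
          (∀ N : ℕ+,
            ((I N).samples : ℝ) ≤ c₁ * k * Real.log (N : ℕ) ^ 3 * (ε ^ 2 * SNR)⁻¹ ∧
            ((I N).memoryBits : ℝ) ≤ c₂ * k * Real.log (N : ℕ) ^ 3 * (ε ^ 2 * SNR)⁻¹ ∧
            ((I N).operations : ℝ) ≤
              c₃ * k * Real.log (N : ℕ) ^ 3 * (ε ^ 2 * SNR)⁻¹ + (k : ℝ) ^ 2) ∧
          ∀ P : ℕ+ → Measure ℂ,
            (∀ N : ℕ+, SparseFourier.IsSubgaussianNoise (P N) (s ^ 2 / (N : ℕ))) →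
            ∀ ω : (N : ℕ+) → Fin k → ZMod (N : ℕ),
              (∀ᶠ N : ℕ+ in atTop, Function.Injective (ω N)) →
              ∀ j : Fin k,
                Tendsto (fun N : ℕ+ => (I N).detectionProb μ A ε (P N) (ω N) j) atTop (𝓝 1) := by
  refine ⟨1, 1, 1, one_pos, one_pos, one_pos, fun k A ε s hk hA hε₀ hε hs => ?_⟩
  intro SNR μ
  have hk' : (0 : ℝ) < k := by exact_mod_cast hk
  have hR : 0 < (k : ℝ) * (ε ^ 2 * SNR)⁻¹ := by positivity
  -- The budget is the stated bound itself; the choice of implementation depends neither on the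
  -- noise laws nor on the frequencies.
  refine ⟨fun N => SparseFourier.budgetImpl ((k : ℝ) * (ε ^ 2 * SNR)⁻¹) (N : ℕ), fun N => ?_,
    fun P hP ω hω j =>
      SparseFourier.tendsto_detectionProb_budgetImpl hκ₁ hR hk hA hε₀ hε hs hP hω j⟩
  obtain ⟨h1, h2, h3⟩ := SparseFourier.costLe_budgetImpl hR.le (N : ℕ)
  have e : (1 : ℝ) * k * Real.log (N : ℕ) ^ 3 * (ε ^ 2 * SNR)⁻¹ =
      (k : ℝ) * (ε ^ 2 * SNR)⁻¹ * Real.log (N : ℕ) ^ 3 := by ring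
  rw [e]
  exact ⟨h1, h2, h3.trans (le_add_of_nonneg_right (sq_nonneg _))⟩
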